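/- Let $\mathbf{Prof}$ be the (pseudo) double category whose objects are small categories, whose vertical morphisms are functors, whose horizontal morphisms $u:\mathcal C\to\mathcal D$ are profunctors, i.e. functors $u:\mathcal C^{op}\times\mathcal D\to\mathbf{Set}$, composed by the coend formula $(v\otimes u)(c,e)=\int^{d} v(d,e)\times u(c,d)$ with identities $\hom_{\mathcal C}$, and whose cells from $u$ to $v$ with sides $F,G$ are the functors $\mathrm{col}(u)\to\mathrm{col}(v)$ between collages restricting to $F$ and $G$ (equivalently, the natural families of maps $u(c,d)\to v(Fc,Gd)$). Let $\mathcal A$ be a small category. A lax $\mathcal A$-indexed horizontal diagram $X$ in $\mathbf{Prof}$ is a lax functor from $\mathcal A$ to the horizontal bicategory of $\mathbf{Prof}$: categories $X_a$, profunctors $X_f:X_a\to X_b$ for $f:a\to b$, and coherent comparison cells $\hom_{X_a}\Rightarrow X_{1_a}$ and $X_g\otimes X_f\Rightarrow X_{gf}$. It is normal if the unit comparisons $\hom_{X_a}\Rightarrow X_{1_a}$ are invertible. A vertical transformation $X\Rightarrow Y$ consists of functors $X_a\to Y_a$ and cells $X_f\Rightarrow Y_f$ compatible with the comparisons. A cocone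 under $X$ with vertex a category $\mathcal V$ consists of functors $X_a\to\mathcal V$ and cells $X_f\Rightarrow\hom_{\mathcal V}$ compatible with the comparisons, and the double colimit $\mathrm{dcolim}\,X$ is the vertex of an initial cocone. The canonical cocone with vertex $\mathcal A$ (constant at $a$ on $X_a$ and at $f$ on $X_f$) induces a functor $\mathrm{dcolim}\,X\to\mathcal A$. Theorem. (1) Every lax $\mathcal A$-indexed horizontal diagram in $\mathbf{Prof}$ has a double colimit. (2) For every choice of double colimits, the resulting functor $\mathrm{dcolim}$, from lax $\mathcal A$-indexed diagrams and vertical transformations to the slice category $\mathbf{Cat}/\mathcal A$, restricts on the normal lax diagrams to an equivalence of categories $$\mathrm{dcolim}:[\mathcal A,\mathbf{Prof}]_{lax}\xrightarrow{\ \sim\ }\mathbf{Cat}/\mathcal A,$$ where $[\mathcal A,\mathbf{Prof}]_{lax}$ denotes the category of normal lax $\mathcal A$-indexed diagrams and vertical transformations. A quasi-inverse sends $p:\mathcal X\to\mathcal A$ to a diagram isomorphic to the diagram of fibres of $p$, which consists of the fibres $\mathcal X_a=p^{-1}(a)$ over objects and of the profunctors $\mathcal X_f$ over morphisms $f:a\to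 b$, where $\mathcal X_f(x,y)$ is the set of morphisms $x\to y$ of $\mathcal X$ lying over $f$. (3) For every functor $p:\mathcal X\to\mathcal A$ from a small category, the diagram of fibres is normal, $\mathcal X$ with the inclusions of the fibres is its double colimit, and the induced functor $\mathcal X\to\mathcal A$ is $p$. -/

import Mathlib

open CategoryTheory Opposite

universe u v₁ u₁ v₂ u₂ w t

attribute [-instance] catToReflQuiver

set_option linter.checkUnivs false in
/-- A (pseudo) double category whose objects and vertical morphisms form the category `D`.
Vertical composition is strict, horizontal composition is associative and unital up to coherent
invertible globular cells.  A cell `Cell u F G v` has top `u`, bottom `v`, left side `F`, right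
side `G`.  As vertical composition is strict only up to propositional equality of boundaries,
equations between cells whose boundaries are equal but not syntactically so are written with
`HEq`. -/
class DoubleCategory (D : Type u₁) [Category.{v₁} D] where
  /-- horizontal morphisms -/
  Hor : D → D → Type w
  /-- cells -/
  Cell {a b c d : D} (u : Hor a b) (F : a ⟶ c) (G : b ⟶ d) (v : Hor c d) : Type t
  /-- vertical identity of a horizontal morphism -/
  idCell {a b : D} (u : Hor a b) : Cell u (𝟙 a) (𝟙 b) u
  /-- vertical composition of cells -/
  vcomp {a b c d e f : D} {u : Hor a b} {v : Hor c d} {w : Hor e f} {F : a ⟶ c} {G : b ⟶ d}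
    {F' : c ⟶ e} {G' : d ⟶ f} (α : Cell u F G v) (β : Cell v F' G' w) :
    Cell u (F ≫ F') (G ≫ G') w
  id_vcomp {a b c d : D} {u : Hor a b} {v : Hor c d} {F : a ⟶ c} {G : b ⟶ d}
    (α : Cell u F G v) : HEq (vcomp (idCell u) α) α
  vcomp_id {a b c d : D} {u : Hor a b} {v : Hor c d} {F : a ⟶ c} {G : b ⟶ d}
    (α : Cell u F G v) : HEq (vcomp α (idCell v)) α
  vcomp_assoc {a b c d e f g h : D} {u : Hor a b} {v : Hor c d} {w : Hor e f} {x : Hor g h}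
    {F : a ⟶ c} {G : b ⟶ d} {F' : c ⟶ e} {G' : d ⟶ f} {F'' : e ⟶ g} {G'' : f ⟶ h}
    (α : Cell u F G v) (β : Cell v F' G' w) (γ : Cell w F'' G'' x) :
    HEq (vcomp (vcomp α β) γ) (vcomp α (vcomp β γ))
  /-- horizontal identity of an object -/
  hid (a : D) : Hor a a
  /-- horizontal identity of a vertical morphism -/
  hidCell {a b : D} (F : a ⟶ b) : Cell (hid a) F F (hid b)
  hidCell_id (a : D) : hidCell (𝟙 a) = idCell (hid a)
  hidCell_comp {a b c : D} (F : a ⟶ b) (G : b ⟶ c) :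
    hidCell (F ≫ G) = vcomp (hidCell F) (hidCell G)
  /-- horizontal composition of horizontal morphisms (in diagrammatic order) -/
  hcomp {a b c : D} (u : Hor a b) (v : Hor b c) : Hor a c
  /-- horizontal composition of cells -/
  hcompCell {a b c a' b' c' : D} {u : Hor a b} {v : Hor b c} {u' : Hor a' b'} {v' : Hor b' c'}
    {F : a ⟶ a'} {G : b ⟶ b'} {H : c ⟶ c'} (α : Cell u F G u') (β : Cell v G H v') :
    Cell (hcomp u v) F H (hcomp u' v')
  hcompCell_id {a b c : D} (u : Hor a b) (v : Hor b c) :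
    hcompCell (idCell u) (idCell v) = idCell (hcomp u v)
  interchange {a b c a' b' c' a'' b'' c'' : D} {u : Hor a b} {v : Hor b c} {u' : Hor a' b'}
    {v' : Hor b' c'} {u'' : Hor a'' b''} {v'' : Hor b'' c''}
    {F : a ⟶ a'} {G : b ⟶ b'} {H : c ⟶ c'} {F' : a' ⟶ a''} {G' : b' ⟶ b''} {H' : c' ⟶ c''}
    (α : Cell u F G u') (β : Cell v G H v') (α' : Cell u' F' G' u'') (β' : Cell v' G' H' v'') :
    hcompCell (vcomp α α') (vcomp β β') = vcomp (hcompCell α β) (hcompCell α' β')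
  /-- associator -/
  assoc {a b c d : D} (u : Hor a b) (v : Hor b c) (w : Hor c d) :
    Cell (hcomp (hcomp u v) w) (𝟙 a) (𝟙 d) (hcomp u (hcomp v w))
  /-- inverse of the associator -/
  assocInv {a b c d : D} (u : Hor a b) (v : Hor b c) (w : Hor c d) :
    Cell (hcomp u (hcomp v w)) (𝟙 a) (𝟙 d) (hcomp (hcomp u v) w)
  assoc_assocInv {a b c d : D} (u : Hor a b) (v : Hor b c) (w : Hor c d) :
    HEq (vcomp (assoc u v w) (assocInv u v w)) (idCell (hcomp (hcomp u v) w))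
  assocInv_assoc {a b c d : D} (u : Hor a b) (v : Hor b c) (w : Hor c d) :
    HEq (vcomp (assocInv u v w) (assoc u v w)) (idCell (hcomp u (hcomp v w)))
  assoc_naturality {a b c d a' b' c' d' : D} {u : Hor a b} {v : Hor b c} {w : Hor c d}
    {u' : Hor a' b'} {v' : Hor b' c'} {w' : Hor c' d'}
    {F : a ⟶ a'} {G : b ⟶ b'} {H : c ⟶ c'} {K : d ⟶ d'}
    (α : Cell u F G u') (β : Cell v G H v') (γ : Cell w H K w') :
    HEq (vcomp (hcompCell (hcompCell α β) γ) (assoc u' v' w'))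
      (vcomp (assoc u v w) (hcompCell α (hcompCell β γ)))
  /-- left unitor -/
  leftUnitor {a b : D} (u : Hor a b) : Cell (hcomp (hid a) u) (𝟙 a) (𝟙 b) u
  /-- inverse of the left unitor -/
  leftUnitorInv {a b : D} (u : Hor a b) : Cell u (𝟙 a) (𝟙 b) (hcomp (hid a) u)
  leftUnitor_inv {a b : D} (u : Hor a b) :
    HEq (vcomp (leftUnitor u) (leftUnitorInv u)) (idCell (hcomp (hid a) u))
  inv_leftUnitor {a b : D} (u : Hor a b) :
    HEq (vcomp (leftUnitorInv u) (leftUnitor u)) (idCell u)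
  leftUnitor_naturality {a b c d : D} {u : Hor a b} {v : Hor c d} {F : a ⟶ c} {G : b ⟶ d}
    (α : Cell u F G v) :
    HEq (vcomp (hcompCell (hidCell F) α) (leftUnitor v)) (vcomp (leftUnitor u) α)
  /-- right unitor -/
  rightUnitor {a b : D} (u : Hor a b) : Cell (hcomp u (hid b)) (𝟙 a) (𝟙 b) u
  /-- inverse of the right unitor -/
  rightUnitorInv {a b : D} (u : Hor a b) : Cell u (𝟙 a) (𝟙 b) (hcomp u (hid b))
  rightUnitor_inv {a b : D} (u : Hor a b) :
    HEq (vcomp (rightUnitor u) (rightUnitorInv u)) (idCell (hcomp u (hid b)))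
  inv_rightUnitor {a b : D} (u : Hor a b) :
    HEq (vcomp (rightUnitorInv u) (rightUnitor u)) (idCell u)
  rightUnitor_naturality {a b c d : D} {u : Hor a b} {v : Hor c d} {F : a ⟶ c} {G : b ⟶ d}
    (α : Cell u F G v) :
    HEq (vcomp (hcompCell α (hidCell G)) (rightUnitor v)) (vcomp (rightUnitor u) α)
  pentagon {a b c d e : D} (u : Hor a b) (v : Hor b c) (w : Hor c d) (x : Hor d e) :
    HEq (vcomp (assoc (hcomp u v) w x) (assoc u v (hcomp w x)))
      (vcomp (vcomp (hcompCell (assoc u v w) (idCell x)) (assoc u (hcomp v w) x))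
        (hcompCell (idCell u) (assoc v w x)))
  triangle {a b c : D} (u : Hor a b) (v : Hor b c) :
    HEq (vcomp (assoc u (hid b) v) (hcompCell (idCell u) (leftUnitor v)))
      (hcompCell (rightUnitor u) (idCell v))

namespace DoubleCategory

section General

variable {D : Type u₁} [Category.{v₁} D] [DoubleCategory.{v₁, u₁, w, t} D]

theorem vcomp_congr {a b c d e f : D} {u u' : Hor a b} {v v' : Hor c d} {w w' : Hor e f}
    {F F₁ : a ⟶ c} {G G₁ : b ⟶ d} {F' F₁' : c ⟶ e} {G' G₁' : d ⟶ f}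
    (hu : u = u') (hv : v = v') (hw : w = w') (hF : F = F₁) (hG : G = G₁)
    (hF' : F' = F₁') (hG' : G' = G₁')
    {α : Cell u F G v} {α' : Cell u' F₁ G₁ v'} {β : Cell v F' G' w} {β' : Cell v' F₁' G₁' w'}
    (hα : HEq α α') (hβ : HEq β β') : HEq (vcomp α β) (vcomp α' β') := by
  subst hu hv hw hF hG hF' hG'
  cases hα
  cases hβ
  rfl

/-- A lax `J`-indexed horizontal diagram in `D`, i.e. a lax functor from the category `J`
to the horizontal bicategory of `D`. -/
structure LaxDiagram (J : Type u₂) [Category.{v₂} J] (D : Type u₁) [Category.{v₁} D]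
    [DoubleCategory.{v₁, u₁, w, t} D] where
  /-- the values on objects -/
  obj : J → D
  /-- the values on morphisms -/
  hor {i j : J} (f : i ⟶ j) : Hor (obj i) (obj j)
  /-- the unit comparison -/
  unit (i : J) : Cell (hid (obj i)) (𝟙 (obj i)) (𝟙 (obj i)) (hor (𝟙 i))
  /-- the composition comparison -/
  mul {i j k : J} (f : i ⟶ j) (g : j ⟶ k) :
    Cell (hcomp (hor f) (hor g)) (𝟙 (obj i)) (𝟙 (obj k)) (hor (f ≫ g))
  mul_assoc {i j k l : J} (f : i ⟶ j) (g : j ⟶ k) (h : k ⟶ l) :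
    HEq (vcomp (hcompCell (mul f g) (idCell (hor h))) (mul (f ≫ g) h))
      (vcomp (assoc (hor f) (hor g) (hor h))
        (vcomp (hcompCell (idCell (hor f)) (mul g h)) (mul f (g ≫ h))))
  unit_mul {i j : J} (f : i ⟶ j) :
    HEq (vcomp (hcompCell (unit i) (idCell (hor f))) (mul (𝟙 i) f)) (leftUnitor (hor f))
  mul_unit {i j : J} (f : i ⟶ j) :
    HEq (vcomp (hcompCell (idCell (hor f)) (unit j)) (mul f (𝟙 j))) (rightUnitor (hor f))

variable {J : Type u₂} [Category.{v₂} J]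

/-- A lax diagram is normal (or unitary) if its unit comparisons are invertible, i.e. if it
preserves horizontal identities up to the given comparison. -/
def LaxDiagram.IsNormal (X : LaxDiagram J D) : Prop :=
  ∀ i : J, ∃ β : Cell (X.hor (𝟙 i)) (𝟙 (X.obj i)) (𝟙 (X.obj i)) (hid (X.obj i)),
    HEq (vcomp (X.unit i) β) (idCell (hid (X.obj i))) ∧
    HEq (vcomp β (X.unit i)) (idCell (X.hor (𝟙 i)))

/-- Vertical transformations between lax horizontal diagrams. -/
@[ext]
structure VerticalTrans (X Y : LaxDiagram J D) where
  /-- the components at objects -/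
  app (i : J) : X.obj i ⟶ Y.obj i
  /-- the components at morphisms -/
  cell {i j : J} (f : i ⟶ j) : Cell (X.hor f) (app i) (app j) (Y.hor f)
  unit (i : J) :
    HEq (vcomp (X.unit i) (cell (𝟙 i))) (vcomp (hidCell (app i)) (Y.unit i))
  mul {i j k : J} (f : i ⟶ j) (g : j ⟶ k) :
    HEq (vcomp (X.mul f g) (cell (f ≫ g))) (vcomp (hcompCell (cell f) (cell g)) (Y.mul f g))

/-- Two vertical transformations agree if their components do. -/
theorem VerticalTrans.ext' {X Y : LaxDiagram J D} {s t : VerticalTrans X Y}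
    (h : ∀ i, s.app i = t.app i)
    (h' : ∀ {i j : J} (f : i ⟶ j), HEq (s.cell f) (t.cell f)) : s = t := by
  obtain ⟨a, c, _, _⟩ := s
  obtain ⟨a', c', _, _⟩ := t
  obtain rfl : a = a' := funext h
  obtain rfl : @c = @c' := by
    funext i j f
    exact eq_of_heq (h' f)
  rfl

/-- The identity vertical transformation. -/
def VerticalTrans.id (X : LaxDiagram J D) : VerticalTrans X X where
  app i := 𝟙 (X.obj i)
  cell f := idCell (X.hor f)
  unit i := by
    rw [hidCell_id]
    exact (vcomp_id _).trans (id_vcomp _).symm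
  mul f g := by
    rw [hcompCell_id]
    exact (vcomp_id _).trans (id_vcomp _).symm

/-- Composition of vertical transformations. -/
def VerticalTrans.comp {X Y Z : LaxDiagram J D} (s : VerticalTrans X Y) (t : VerticalTrans Y Z) :
    VerticalTrans X Z where
  app i := s.app i ≫ t.app i
  cell f := vcomp (s.cell f) (t.cell f)
  unit i := by
    rw [hidCell_comp]
    refine (vcomp_assoc _ _ _).symm.trans ?_
    refine (vcomp_congr rfl rfl rfl (by simp) (by simp) rfl rfl (s.unit i) HEq.rfl).trans ?_
    refine (vcomp_assoc _ _ _).trans ?_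
    refine (vcomp_congr rfl rfl rfl rfl rfl (by simp) (by simp) HEq.rfl (t.unit i)).trans ?_
    exact (vcomp_assoc _ _ _).symm
  mul f g := by
    rw [interchange]
    refine (vcomp_assoc _ _ _).symm.trans ?_
    refine (vcomp_congr rfl rfl rfl (by simp) (by simp) rfl rfl (s.mul f g) HEq.rfl).trans ?_
    refine (vcomp_assoc _ _ _).trans ?_
    refine (vcomp_congr rfl rfl rfl rfl rfl (by simp) (by simp) HEq.rfl (t.mul f g)).trans ?_
    exact (vcomp_assoc _ _ _).symm

/-- The category of lax horizontal diagrams and vertical transformations. -/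
instance : Category (LaxDiagram J D) where
  Hom := VerticalTrans
  id := VerticalTrans.id
  comp := VerticalTrans.comp
  id_comp _ := VerticalTrans.ext' (fun _ => Category.id_comp _) (fun _ => id_vcomp _)
  comp_id _ := VerticalTrans.ext' (fun _ => Category.comp_id _) (fun _ => vcomp_id _)
  assoc _ _ _ := VerticalTrans.ext' (fun _ => Category.assoc _ _ _) (fun _ => vcomp_assoc _ _ _)

/-- Normality as a property of objects of the category of lax diagrams; the normal lax diagrams
form a full subcategory. -/
def normalDiagrams (J : Type u₂) [Category.{v₂} J] (D : Type u₁) [Category.{v₁} D]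
    [DoubleCategory.{v₁, u₁, w, t} D] : ObjectProperty (LaxDiagram J D) :=
  fun X => X.IsNormal

/-- A cocone under a lax horizontal diagram `X`: an object with vertical morphisms from the
`X.obj i` and cells from the `X.hor f` to its horizontal identity, compatible with the
comparison cells of `X`. -/
structure Cocone (X : LaxDiagram J D) where
  /-- the vertex -/
  pt : D
  /-- the components at objects -/
  app (i : J) : X.obj i ⟶ pt
  /-- the components at morphisms -/
  cell {i j : J} (f : i ⟶ j) : Cell (X.hor f) (app i) (app j) (hid pt)
  unit (i : J) : HEq (vcomp (X.unit i) (cell (𝟙 i))) (hidCell (app i))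
  mul {i j k : J} (f : i ⟶ j) (g : j ⟶ k) :
    HEq (vcomp (X.mul f g) (cell (f ≫ g)))
      (vcomp (hcompCell (cell f) (cell g)) (leftUnitor (hid pt)))

/-- A morphism of cocones is a vertical morphism of the vertices which respects the components. -/
@[ext]
structure Cocone.Hom {X : LaxDiagram J D} (c c' : Cocone X) where
  /-- the underlying vertical morphism -/
  hom : c.pt ⟶ c'.pt
  app (i : J) : c.app i ≫ hom = c'.app i
  cell {i j : J} (f : i ⟶ j) : HEq (vcomp (c.cell f) (hidCell hom)) (c'.cell f)

/-- The category of cocones under a lax horizontal diagram. -/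
instance (X : LaxDiagram J D) : Category (Cocone X) where
  Hom := Cocone.Hom
  id c :=
    { hom := 𝟙 c.pt
      app := fun _ => Category.comp_id _
      cell := fun f => by
        rw [hidCell_id]
        exact vcomp_id _ }
  comp {a b c} s t :=
    { hom := s.hom ≫ t.hom
      app := fun i => by rw [← Category.assoc, s.app, t.app]
      cell := fun f => by
        rw [hidCell_comp]
        refine (vcomp_assoc _ _ _).symm.trans ?_
        exact (vcomp_congr rfl rfl rfl (s.app _) (s.app _) rfl rfl (s.cell f) HEq.rfl).trans
          (t.cell f) }
  id_comp _ := Cocone.Hom.ext (Category.id_comp _)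
  comp_id _ := Cocone.Hom.ext (Category.comp_id _)
  assoc _ _ _ := Cocone.Hom.ext (Category.assoc _ _ _)

/-- A cocone is a double colimit if it is initial among all cocones. -/
abbrev Cocone.IsDoubleColimit {X : LaxDiagram J D} (c : Cocone X) := Limits.IsInitial c

/-- Restriction of a cocone along a vertical transformation. -/
abbrev Cocone.precomp {X Y : LaxDiagram J D} (s : X ⟶ Y) (c : Cocone Y) : Cocone X where
  pt := c.pt
  app i := VerticalTrans.app s i ≫ c.app i
  cell f := vcomp (VerticalTrans.cell s f) (c.cell f)
  unit i := by
    rw [hidCell_comp]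
    refine (vcomp_assoc _ _ _).symm.trans ?_
    refine (vcomp_congr rfl rfl rfl (by simp) (by simp) rfl rfl
      (VerticalTrans.unit s i) HEq.rfl).trans ?_
    refine (vcomp_assoc _ _ _).trans ?_
    exact vcomp_congr rfl rfl rfl rfl rfl (by simp) (by simp) HEq.rfl (c.unit i)
  mul f g := by
    rw [interchange]
    refine (vcomp_assoc _ _ _).symm.trans ?_
    refine (vcomp_congr rfl rfl rfl (by simp) (by simp) rfl rfl
      (VerticalTrans.mul s f g) HEq.rfl).trans ?_
    refine (vcomp_assoc _ _ _).trans ?_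
    refine (vcomp_congr rfl rfl rfl rfl rfl (by simp) (by simp) HEq.rfl (c.mul f g)).trans ?_
    exact (vcomp_assoc _ _ _).symm

/-- A choice of a double colimit for every lax `J`-indexed horizontal diagram in `D`. -/
structure DoubleColimits (J : Type u₂) [Category.{v₂} J] (D : Type u₁) [Category.{v₁} D]
    [DoubleCategory.{v₁, u₁, w, t} D] where
  /-- the chosen cocone -/
  cocone (X : LaxDiagram J D) : Cocone X
  /-- its universal property -/
  isDoubleColimit (X : LaxDiagram J D) : (cocone X).IsDoubleColimit

namespace DoubleColimits

variable (K : DoubleColimits J D)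

/-- The vertical morphism out of the chosen double colimit induced by a cocone. -/
def desc {X : LaxDiagram J D} (c : Cocone X) : (K.cocone X).pt ⟶ c.pt :=
  Cocone.Hom.hom ((K.isDoubleColimit X).to c)

theorem app_desc {X : LaxDiagram J D} (c : Cocone X) (i : J) :
    (K.cocone X).app i ≫ K.desc c = c.app i :=
  Cocone.Hom.app ((K.isDoubleColimit X).to c) i

theorem cell_desc {X : LaxDiagram J D} (c : Cocone X) {i j : J} (f : i ⟶ j) :
    HEq (vcomp ((K.cocone X).cell f) (hidCell (K.desc c))) (c.cell f) :=
  Cocone.Hom.cell ((K.isDoubleColimit X).to c) f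

theorem desc_eq {X : LaxDiagram J D} (c : Cocone X) (h : (K.cocone X).pt ⟶ c.pt)
    (happ : ∀ i, (K.cocone X).app i ≫ h = c.app i)
    (hcell : ∀ {i j : J} (f : i ⟶ j),
      HEq (vcomp ((K.cocone X).cell f) (hidCell h)) (c.cell f)) :
    K.desc c = h :=
  congrArg Cocone.Hom.hom
    ((K.isDoubleColimit X).hom_ext ((K.isDoubleColimit X).to c) (Cocone.Hom.mk h happ hcell))

theorem desc_comp_desc {X Y : LaxDiagram J D} (s : X ⟶ Y) (c : Cocone Y) :
    K.desc ((K.cocone Y).precomp s) ≫ K.desc c = K.desc (c.precomp s) := by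
  refine (K.desc_eq (c.precomp s) (K.desc ((K.cocone Y).precomp s) ≫ K.desc c)
    (fun i => ?_) (fun f => ?_)).symm
  · refine (Category.assoc _ _ _).symm.trans ?_
    rw [app_desc]
    refine (Category.assoc _ _ _).trans ?_
    rw [app_desc]
  · rw [hidCell_comp]
    refine (vcomp_assoc _ _ _).symm.trans ?_
    refine (vcomp_congr (α := vcomp ((K.cocone X).cell f)
      (hidCell (K.desc ((K.cocone Y).precomp s)))) (β := hidCell (K.desc c))
      rfl rfl rfl (K.app_desc _ _) (K.app_desc _ _) rfl rfl
      (K.cell_desc ((K.cocone Y).precomp s) f) HEq.rfl).trans ?_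
    refine (vcomp_assoc _ _ _).trans ?_
    exact vcomp_congr rfl rfl rfl rfl rfl (K.app_desc _ _) (K.app_desc _ _) HEq.rfl
      (K.cell_desc c f)

/-- Taking double colimits, as a functor from lax diagrams and vertical transformations to
objects and vertical morphisms: a vertical transformation `s : X ⟶ Y` is sent to the morphism
induced by the restriction of the chosen cocone of `Y` along `s`. -/
def dcolim : LaxDiagram J D ⥤ D where
  obj X := (K.cocone X).pt
  map {_ Y} s := K.desc ((K.cocone Y).precomp s)
  map_id X := K.desc_eq ((K.cocone X).precomp (𝟙 X)) (𝟙 (K.cocone X).pt)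
    (fun _ => (Category.comp_id _).trans (Category.id_comp _).symm)
    (fun f => by
      rw [hidCell_id]
      exact (vcomp_id _).trans (id_vcomp _).symm)
  map_comp {X Y Z} s t := by
    refine Eq.trans ?_ (K.desc_comp_desc s ((K.cocone Z).precomp t)).symm
    refine K.desc_eq _ _ (fun i => (K.app_desc _ i).trans ?_)
      (fun f => (K.cell_desc _ f).trans ?_)
    · exact (Category.assoc _ _ _).symm
    · exact (vcomp_assoc _ _ _).symm

end DoubleColimits

end General

end DoubleCategory

namespace Prof

open DoubleCategory

/-- A `(C, D)`-profunctor: a functor `Cᵒᵖ × D ⥤ Set`. -/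
abbrev Profunc (C D : Type u) [SmallCategory C] [SmallCategory D] : Type (u + 1) :=
  Cᵒᵖ × D ⥤ Type u

section Basic

variable {C D E : Type u} [SmallCategory C] [SmallCategory D] [SmallCategory E]

/-- The set `p(c, d)`. -/
abbrev El (p : Profunc C D) (c : C) (d : D) : Type u := p.obj (op c, d)

/-- The action `(f, g)(x)` of morphisms on elements of a profunctor. -/
def act (p : Profunc C D) {c c' : C} {d d' : D} (f : c' ⟶ c) (g : d ⟶ d') (x : El p c d) :
    El p c' d' :=
  p.map ((f.op, g) : (op c, d) ⟶ (op c', d')) x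

@[simp]
theorem act_id (p : Profunc C D) {c : C} {d : D} (x : El p c d) : act p (𝟙 c) (𝟙 d) x = x :=
  p.map_id_apply (op c, d) x

@[simp]
theorem act_act (p : Profunc C D) {c c' c'' : C} {d d' d'' : D} (f : c' ⟶ c) (g : d ⟶ d')
    (f' : c'' ⟶ c') (g' : d' ⟶ d'') (x : El p c d) :
    act p f' g' (act p f g x) = act p (f' ≫ f) (g ≫ g') x :=
  (p.map_comp_apply ((f.op, g) : (op c, d) ⟶ (op c', d'))
    ((f'.op, g') : (op c', d') ⟶ (op c'', d'')) x).symm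

theorem act_act' (p : Profunc C D) {c c' c'' : C} {d d' d'' : D} {f : c' ⟶ c} {g : d ⟶ d'}
    {f' : c'' ⟶ c'} {g' : d' ⟶ d''} {f'' : c'' ⟶ c} {g'' : d ⟶ d''} (hf : f' ≫ f = f'')
    (hg : g ≫ g' = g'') (x : El p c d) : act p f' g' (act p f g x) = act p f'' g'' x := by
  rw [act_act, hf, hg]

/-- Constructor for profunctors from sets of elements and an action. -/
def ofAct (S : C → D → Type u)
    (a : ∀ {c c' : C} {d d' : D}, (c' ⟶ c) → (d ⟶ d') → S c d → S c' d')
    (a_id : ∀ {c : C} {d : D} (x : S c d), a (𝟙 c) (𝟙 d) x = x)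
    (a_comp : ∀ {c c' c'' : C} {d d' d'' : D} (f : c' ⟶ c) (g : d ⟶ d')
      (f' : c'' ⟶ c') (g' : d' ⟶ d'') (x : S c d), a f' g' (a f g x) = a (f' ≫ f) (g ≫ g') x) :
    Profunc C D where
  obj X := S (unop X.1) X.2
  map f := TypeCat.ofHom (a f.1.unop f.2)
  map_id X := by
    ext x
    exact a_id x
  map_comp f g := by
    ext x
    exact (a_comp _ _ _ _ x).symm

/-- The identity profunctor `hom : Cᵒᵖ × C ⥤ Set`. -/
def homProf (C : Type u) [SmallCategory C] : Profunc C C :=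
  ofAct (fun c d => c ⟶ d) (fun f g x => f ≫ x ≫ g) (by simp) (by simp)

/-- The relation defining the coend `∫^d u(c, d) × v(d, e)`. -/
inductive TensorRel (u : Profunc C D) (v : Profunc D E) (c : C) (e : E) :
    (Σ d : D, El u c d × El v d e) → (Σ d : D, El u c d × El v d e) → Prop
  | mk {d d' : D} (k : d ⟶ d') (x : El u c d) (y : El v d' e) :
      TensorRel u v c e ⟨d', act u (𝟙 c) k x, y⟩ ⟨d, x, act v k (𝟙 e) y⟩

/-- The coend `∫^d u(c, d) × v(d, e)`, as a quotient of the disjoint union. -/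
def Tensor (u : Profunc C D) (v : Profunc D E) (c : C) (e : E) : Type u :=
  Quot (TensorRel u v c e)

variable {u : Profunc C D} {v : Profunc D E}

/-- The class of a pair `(x, y)` in the coend. -/
def tmul {c : C} {d : D} {e : E} (x : El u c d) (y : El v d e) : Tensor u v c e :=
  Quot.mk _ ⟨d, x, y⟩

theorem tmul_act {c : C} {d d' : D} {e : E} (k : d ⟶ d') (x : El u c d) (y : El v d' e) :
    tmul (u := u) (v := v) (act u (𝟙 c) k x) y = tmul x (act v k (𝟙 e) y) :=
  Quot.sound (TensorRel.mk k x y)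

theorem Tensor.ind {c : C} {e : E} {P : Tensor u v c e → Prop}
    (h : ∀ (d : D) (x : El u c d) (y : El v d e), P (tmul x y)) (z : Tensor u v c e) : P z :=
  Quot.ind (fun ⟨d, x, y⟩ => h d x y) z

/-- Functions out of the coend. -/
def Tensor.lift {c : C} {e : E} {S : Type u} (f : ∀ d : D, El u c d → El v d e → S)
    (hf : ∀ {d d' : D} (k : d ⟶ d') (x : El u c d) (y : El v d' e),
      f d' (act u (𝟙 c) k x) y = f d x (act v k (𝟙 e) y))
    (z : Tensor u v c e) : S :=
  Quot.lift (fun z => f z.1 z.2.1 z.2.2) (by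
    rintro _ _ ⟨k, x, y⟩
    exact hf k x y) z

/-- Composition of profunctors by the coend formula. -/
def tensor (u : Profunc C D) (v : Profunc D E) : Profunc C E :=
  ofAct (Tensor u v)
    (fun {c c' e e'} f g => Tensor.lift
      (fun d x y => tmul (act u f (𝟙 d) x) (act v (𝟙 d) g y))
      (fun {d d'} k x y => by
        have := tmul_act (u := u) (v := v) k (act u f (𝟙 d) x) (act v (𝟙 d') g y)
        simpa using this))
    (fun z => by
      induction z using Tensor.ind with
      | h d x y => exact congrArg₂ tmul (act_id _ _) (act_id _ _))
    (fun f g f' g' z => by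
      induction z using Tensor.ind with
      | h d x y => exact congrArg₂ tmul (by simp) (by simp))

end Basic

/-- A cell of `Prof` with top `u : Cᵒᵖ × D ⥤ Set`, bottom `v : C'ᵒᵖ × D' ⥤ Set` and sides
`F : C ⥤ C'`, `G : D ⥤ D'`, given by its action on the elements of `u`.  By `cellEquivCollageMap`
below this is the same as a functor from the collage of `u` to the collage of `v` which
restricts to `F` and `G`. -/
structure ProfCell {C D C' D' : Type u} [SmallCategory C] [SmallCategory D] [SmallCategory C']
    [SmallCategory D'] (u : Profunc C D) (F : C ⥤ C') (G : D ⥤ D') (v : Profunc C' D') :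
    Type u where
  /-- the action on elements -/
  app {c : C} {d : D} (x : El u c d) : El v (F.obj c) (G.obj d)
  naturality {c c' : C} {d d' : D} (f : c' ⟶ c) (g : d ⟶ d') (x : El u c d) :
    app (act u f g x) = act v (F.map f) (G.map g) (app x)

attribute [simp] ProfCell.naturality

section Collage

variable {C D C' D' : Type u} [SmallCategory C] [SmallCategory D] [SmallCategory C']
    [SmallCategory D']

@[ext]
theorem ProfCell.ext {u : Profunc C D} {F : C ⥤ C'} {G : D ⥤ D'} {v : Profunc C' D'}
    {α β : ProfCell u F G v} (h : ∀ {c : C} {d : D} (x : El u c d), α.app x = β.app x) :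
    α = β := by
  obtain ⟨a, _⟩ := α
  obtain ⟨b, _⟩ := β
  obtain rfl : @a = @b := by
    funext c d x
    exact h x
  rfl

/-- Objects of the collage of a profunctor. -/
inductive Collage (u : Profunc C D) : Type u
  | inl (c : C) : Collage u
  | inr (d : D) : Collage u

/-- Morphisms of the collage: those of `C`, those of `D`, and the elements of `u`. -/
def Collage.Hom {u : Profunc C D} : Collage u → Collage u → Type u
  | .inl c, .inl c' => c ⟶ c'
  | .inl c, .inr d => El u c d
  | .inr _, .inl _ => PEmpty
  | .inr d, .inr d' => d ⟶ d'

/-- Identities of the collage. -/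
def Collage.id {u : Profunc C D} : ∀ x : Collage u, Collage.Hom x x
  | .inl c => 𝟙 c
  | .inr d => 𝟙 d

/-- Composition in the collage, given by the functoriality of `u`. -/
def Collage.comp {u : Profunc C D} :
    ∀ {x y z : Collage u}, Collage.Hom x y → Collage.Hom y z → Collage.Hom x z
  | .inl _, .inl _, .inl _, f, g => CategoryStruct.comp (obj := C) f g
  | .inl _, .inl _, .inr d, f, x => act u f (𝟙 d) x
  | .inl c, .inr _, .inr _, x, g => act u (𝟙 c) g x
  | .inr _, .inr _, .inr _, f, g => CategoryStruct.comp (obj := D) f g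
  | .inr _, .inl _, _, f, _ => PEmpty.elim f
  | _, .inr _, .inl _, _, f => PEmpty.elim f

/-- The collage of a profunctor. -/
instance (u : Profunc C D) : SmallCategory (Collage u) where
  Hom := Collage.Hom
  id := Collage.id
  comp := Collage.comp
  id_comp {x y} f := by
    rcases x with c | d <;> rcases y with c' | d'
    · exact Category.id_comp (obj := C) f
    · exact act_id u f
    · exact PEmpty.elim f
    · exact Category.id_comp (obj := D) f
  comp_id {x y} f := by
    rcases x with c | d <;> rcases y with c' | d'
    · exact Category.comp_id (obj := C) f
    · exact act_id u f
    · exact PEmpty.elim f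
    · exact Category.comp_id (obj := D) f
  assoc {w x y z} f g h := by
    rcases w with _ | _ <;> rcases x with _ | _ <;> rcases y with _ | _ <;> rcases z with _ | _ <;>
      first
        | exact PEmpty.elim f
        | exact PEmpty.elim g
        | exact PEmpty.elim h
        | exact Category.assoc (obj := C) f g h
        | exact Category.assoc (obj := D) f g h
        | exact (act_act' u rfl (Category.comp_id _) h).symm
        | exact (act_act' u (Category.id_comp _) (Category.id_comp _) g).trans
            (act_act' u (Category.comp_id _) (Category.comp_id _) g).symm
        | exact act_act' u (Category.comp_id _) rfl f

/-- The inclusion of `C` in the collage. -/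
def Collage.inlFunctor (u : Profunc C D) : C ⥤ Collage u where
  obj c := .inl c
  map f := f
  map_id _ := rfl
  map_comp _ _ := rfl

/-- The inclusion of `D` in the collage. -/
def Collage.inrFunctor (u : Profunc C D) : D ⥤ Collage u where
  obj d := .inr d
  map f := f
  map_id _ := rfl
  map_comp _ _ := rfl

/-- Functors between collages restricting to `F` and `G`. -/
abbrev CollageMap (u : Profunc C D) (F : C ⥤ C') (G : D ⥤ D') (v : Profunc C' D') : Type u :=
  { Φ : Collage u ⥤ Collage v //
    Collage.inlFunctor u ⋙ Φ = F ⋙ Collage.inlFunctor v ∧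
    Collage.inrFunctor u ⋙ Φ = G ⋙ Collage.inrFunctor v }

variable {u : Profunc C D} {F : C ⥤ C'} {G : D ⥤ D'} {v : Profunc C' D'}

/-- The functor between collages given by a cell. -/
def ProfCell.toFunctor (α : ProfCell u F G v) : Collage u ⥤ Collage v where
  obj
    | .inl c => .inl (F.obj c)
    | .inr d => .inr (G.obj d)
  map {x y} f := match x, y, f with
    | .inl _, .inl _, f => F.map f
    | .inl _, .inr _, x => α.app x
    | .inr _, .inl _, f => PEmpty.elim f
    | .inr _, .inr _, g => G.map g
  map_id
    | .inl c => F.map_id c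
    | .inr d => G.map_id d
  map_comp {x y z} f g := by
    rcases x with c | d <;> rcases y with c' | d' <;> rcases z with c'' | d''
    · exact F.map_comp f g
    · exact (α.naturality f (𝟙 d'') g).trans (by rw [G.map_id]; rfl)
    · exact PEmpty.elim g
    · exact (α.naturality (𝟙 c) g f).trans (by rw [F.map_id]; rfl)
    · exact PEmpty.elim f
    · exact PEmpty.elim f
    · exact PEmpty.elim g
    · exact G.map_comp f g

theorem Collage.comp_inl_inr {c c' : C} {d : D} (f : c' ⟶ c) (x : El u c d) :
    CategoryStruct.comp (obj := Collage u) (X := .inl c') (Y := .inl c) (Z := .inr d) f x =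
      act u f (𝟙 d) x := rfl

theorem Collage.comp_inr_inr {c : C} {d d' : D} (g : d ⟶ d') (x : El u c d) :
    CategoryStruct.comp (obj := Collage u) (X := .inl c) (Y := .inr d) (Z := .inr d') x g =
      act u (𝟙 c) g x := rfl

theorem Collage.act_eq {c c' : C} {d d' : D} (f : c' ⟶ c) (g : d ⟶ d') (x : El u c d) :
    act u f g x = CategoryStruct.comp (obj := Collage u) (X := .inl c') (Y := .inl c) (Z := .inr d')
      f (CategoryStruct.comp (obj := Collage u) (X := .inl c) (Y := .inr d) (Z := .inr d') x g) := by
  rw [Collage.comp_inr_inr, Collage.comp_inl_inr, act_act]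
  simp

theorem conj_eqToHom_map {K L : Type u} [SmallCategory K] [SmallCategory L] (Φ : K ⥤ L)
    {p q r s : K} (f : p ⟶ q) (x : q ⟶ r) (g : r ⟶ s) {P Q R S : L}
    (hp : Φ.obj p = P) (hq : Φ.obj q = Q) (hr : Φ.obj r = R) (hs : Φ.obj s = S)
    {f' : P ⟶ Q} {g' : R ⟶ S}
    (hf : Φ.map f = eqToHom hp ≫ f' ≫ eqToHom hq.symm)
    (hg : Φ.map g = eqToHom hr ≫ g' ≫ eqToHom hs.symm) :
    eqToHom hp.symm ≫ Φ.map (f ≫ x ≫ g) ≫ eqToHom hs =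
      f' ≫ (eqToHom hq.symm ≫ Φ.map x ≫ eqToHom hr) ≫ g' := by
  subst hp hq hr hs
  simp only [eqToHom_refl, Category.id_comp, Category.comp_id] at hf hg ⊢
  rw [← hf, ← hg, Functor.map_comp, Functor.map_comp]

/-- Cells of `Prof` are the same as functors between collages restricting to the given
functors. -/
def cellEquivCollageMap : ProfCell u F G v ≃ CollageMap u F G v where
  toFun α := ⟨α.toFunctor, rfl, rfl⟩
  invFun Φ :=
    { app := fun {c d} x =>
        (eqToHom (Functor.congr_obj Φ.2.1 c).symm ≫ Φ.1.map (X := .inl c) (Y := .inr d) x ≫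
          eqToHom (Functor.congr_obj Φ.2.2 d) :
            (Collage.inl (F.obj c) : Collage v) ⟶ Collage.inr (G.obj d))
      naturality := fun {c c' d d'} f g x => by
        rw [Collage.act_eq]
        refine Eq.trans ?_ (Collage.act_eq (F.map f) (G.map g) _).symm
        exact conj_eqToHom_map Φ.1 (p := .inl c') (q := .inl c) (r := .inr d) (s := .inr d')
          f x g (Functor.congr_obj Φ.2.1 c') (Functor.congr_obj Φ.2.1 c)
          (Functor.congr_obj Φ.2.2 d) (Functor.congr_obj Φ.2.2 d')
          (Functor.congr_hom Φ.2.1 f) (Functor.congr_hom Φ.2.2 g) }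
  left_inv α := by
    ext c d x
    exact (Category.id_comp (obj := Collage v) _).trans (Category.comp_id (obj := Collage v) _)
  right_inv Φ := by
    apply Subtype.ext
    refine CategoryTheory.Functor.ext ?_ ?_
    · rintro (c | d)
      · exact (Functor.congr_obj Φ.2.1 c).symm
      · exact (Functor.congr_obj Φ.2.2 d).symm
    · rintro (c | d) (c' | d') f
      · exact Functor.congr_hom Φ.2.1.symm f
      · rfl
      · exact PEmpty.elim f
      · exact Functor.congr_hom Φ.2.2.symm f

end Collage

section Instance

variable {B C D E B' C' D' E' C'' D'' : Type u} [SmallCategory B] [SmallCategory C]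
  [SmallCategory D] [SmallCategory E] [SmallCategory B'] [SmallCategory C'] [SmallCategory D']
  [SmallCategory E'] [SmallCategory C''] [SmallCategory D'']

/-- The identity cell of a profunctor. -/
def ProfCell.id (u : Profunc C D) : ProfCell u (𝟭 C) (𝟭 D) u where
  app x := x
  naturality _ _ _ := rfl

/-- Vertical composition of cells. -/
def ProfCell.vcomp {u : Profunc C D} {v : Profunc C' D'} {w : Profunc C'' D''}
    {F : C ⥤ C'} {G : D ⥤ D'} {F' : C' ⥤ C''} {G' : D' ⥤ D''}
    (α : ProfCell u F G v) (β : ProfCell v F' G' w) : ProfCell u (F ⋙ F') (G ⋙ G') w where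
  app x := β.app (α.app x)
  naturality f g x := by
    rw [α.naturality, β.naturality]
    rfl

/-- The cell between identity profunctors given by a functor. -/
def ProfCell.hid (F : C ⥤ D) : ProfCell (homProf C) F F (homProf D) where
  app x := F.map x
  naturality f g x := by
    refine (F.map_comp _ _).trans ?_
    exact congrArg (_ ≫ ·) (F.map_comp _ _)

/-- Horizontal composition of cells. -/
def ProfCell.hcomp {u : Profunc B C} {v : Profunc C D} {u' : Profunc B' C'} {v' : Profunc C' D'}
    {F : B ⥤ B'} {G : C ⥤ C'} {H : D ⥤ D'} (α : ProfCell u F G u') (β : ProfCell v G H v') :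
    ProfCell (tensor u v) F H (tensor u' v') where
  app {c e} := Tensor.lift
    (fun _ x y => tmul (u := u') (v := v') (α.app x) (β.app y))
    (fun k x y => by
      rw [α.naturality, β.naturality, F.map_id, H.map_id]
      exact tmul_act _ _ _)
  naturality f g z := by
    induction z using Tensor.ind with
    | h d x y =>
      refine congrArg₂ tmul ((α.naturality _ _ _).trans ?_) ((β.naturality _ _ _).trans ?_)
      · rw [G.map_id]
        rfl
      · rw [G.map_id]

/-- The associator `(x ⊗ y) ⊗ z ↦ x ⊗ (y ⊗ z)`. -/
def assocCell (u : Profunc B C) (v : Profunc C D) (w : Profunc D E) :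
    ProfCell (tensor (tensor u v) w) (𝟭 B) (𝟭 E) (tensor u (tensor v w)) where
  app {c e} := Tensor.lift
    (fun d' t z => Tensor.lift
      (fun d x y => tmul (u := u) (v := tensor v w) x (tmul (u := v) (v := w) y z))
      (fun k x y => by
        refine (tmul_act (u := u) (v := tensor v w) k x (tmul y z)).trans ?_
        refine congrArg (tmul (u := u) (v := tensor v w) x) ?_
        exact congrArg (tmul _) (act_id w z)) t)
    (fun k t z => by
      induction t using Tensor.ind with
      | h d x y =>
        exact congrArg₂ (tmul (u := u) (v := tensor v w)) (act_id u x)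
          (tmul_act (u := v) (v := w) k y z))
  naturality f g t := by
    induction t using Tensor.ind with
    | h d t z =>
      induction t using Tensor.ind with
      | h d x y => rfl

/-- The inverse associator `x ⊗ (y ⊗ z) ↦ (x ⊗ y) ⊗ z`. -/
def assocInvCell (u : Profunc B C) (v : Profunc C D) (w : Profunc D E) :
    ProfCell (tensor u (tensor v w)) (𝟭 B) (𝟭 E) (tensor (tensor u v) w) where
  app {c e} := Tensor.lift
    (fun d' x t => Tensor.lift
      (fun d y z => tmul (u := tensor u v) (v := w) (tmul (u := u) (v := v) x y) z)
      (fun k y z => by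
        refine Eq.trans ?_ (tmul_act (u := tensor u v) (v := w) k (tmul x y) z)
        refine congrArg (fun s => tmul (u := tensor u v) (v := w) s z) ?_
        exact congrArg (fun s => tmul s _) (act_id u x).symm) t)
    (fun k x t => by
      induction t using Tensor.ind with
      | h d y z =>
        exact congrArg₂ (tmul (u := tensor u v) (v := w))
          (tmul_act (u := u) (v := v) k x y) (act_id w z).symm)
  naturality f g t := by
    induction t using Tensor.ind with
    | h d x t =>
      induction t using Tensor.ind with
      | h d y z => rfl

/-- The left unitor `f ⊗ x ↦ f · x`. -/
def leftUnitorCell (u : Profunc C D) : ProfCell (tensor (homProf C) u) (𝟭 C) (𝟭 D) u where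
  app {c d} := Tensor.lift (fun c' (f : c ⟶ c') x => act u f (𝟙 d) x)
    (fun k f x => (congrArg (fun h => act u h (𝟙 _) x) (Category.id_comp _)).trans
      (act_act' u rfl (Category.comp_id _) x).symm)
  naturality f g t := by
    induction t using Tensor.ind with
    | h d h x =>
      refine (act_act' u (f'' := f ≫ h) (g'' := g) ?_ (Category.comp_id _) x).trans
        (act_act' u rfl (Category.id_comp _) x).symm
      exact (Category.comp_id _).trans (congrArg (f ≫ ·) (Category.comp_id _))

/-- The inverse left unitor `x ↦ 1 ⊗ x`. -/
def leftUnitorInvCell (u : Profunc C D) : ProfCell u (𝟭 C) (𝟭 D) (tensor (homProf C) u) where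
  app {c d} x := tmul (u := homProf C) (v := u) (𝟙 c) x
  naturality {c c' d d'} f g x := by
    refine Eq.trans ?_ ((tmul_act (u := homProf C) (v := u) f (𝟙 c')
      (act u (𝟙 c) g x)).symm.trans ?_)
    · exact congrArg (tmul (u := homProf C) (v := u) (𝟙 c'))
        (act_act' u (Category.comp_id f) (Category.comp_id g) x).symm
    · refine congrArg (fun s => tmul (u := homProf C) (v := u) s (act u (𝟙 c) g x)) ?_
      change 𝟙 c' ≫ 𝟙 c' ≫ f = f ≫ 𝟙 c ≫ 𝟙 c
      simp

/-- The right unitor `x ⊗ f ↦ x · f`. -/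
def rightUnitorCell (u : Profunc C D) : ProfCell (tensor u (homProf D)) (𝟭 C) (𝟭 D) u where
  app {c d} := Tensor.lift (fun d' x (f : d' ⟶ d) => act u (𝟙 c) f x)
    (fun k x f => act_act' u (Category.comp_id _) (congrArg (k ≫ ·) (Category.comp_id f).symm) x)
  naturality f g t := by
    induction t using Tensor.ind with
    | h d x h =>
      refine (act_act' u (f'' := f) (g'' := h ≫ g) (Category.id_comp _) ?_ x).trans
        (act_act' u (Category.comp_id _) rfl x).symm
      exact (Category.id_comp _).trans (Category.id_comp _)

/-- The inverse right unitor `x ↦ x ⊗ 1`. -/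
def rightUnitorInvCell (u : Profunc C D) : ProfCell u (𝟭 C) (𝟭 D) (tensor u (homProf D)) where
  app {c d} x := tmul (u := u) (v := homProf D) x (𝟙 d)
  naturality {c c' d d'} f g x := by
    refine Eq.trans ?_ ((tmul_act (u := u) (v := homProf D) g (act u f (𝟙 d) x)
      (𝟙 d')).trans ?_)
    · exact congrArg (fun s => tmul (u := u) (v := homProf D) s (𝟙 d'))
        (act_act' u (Category.id_comp f) (Category.id_comp g) x).symm
    · refine congrArg (tmul (u := u) (v := homProf D) (act u f (𝟙 d) x)) ?_
      change g ≫ 𝟙 d' ≫ 𝟙 d' = 𝟙 d ≫ 𝟙 d ≫ g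
      simp

/-- The double category `Prof`: objects are small categories, vertical morphisms are functors,
horizontal morphisms are profunctors (composed by the coend formula), cells are collage maps. -/
instance prof : DoubleCategory.{u, u + 1, u + 1, u} Cat.{u, u} where
  Hor C D := Profunc C D
  Cell u F G v := ProfCell u F.toFunctor G.toFunctor v
  idCell u := ProfCell.id u
  vcomp α β := ProfCell.vcomp α β
  id_vcomp _ := HEq.rfl
  vcomp_id _ := HEq.rfl
  vcomp_assoc _ _ _ := HEq.rfl
  hid C := homProf C
  hidCell F := ProfCell.hid F.toFunctor
  hidCell_id _ := rfl
  hidCell_comp _ _ := rfl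
  hcomp u v := tensor u v
  hcompCell α β := ProfCell.hcomp α β
  hcompCell_id u v := by
    ext c d z
    induction z using Tensor.ind with
    | h d x y => rfl
  interchange α β α' β' := by
    ext c d z
    induction z using Tensor.ind with
    | h d x y => rfl
  assoc u v w := assocCell u v w
  assocInv u v w := assocInvCell u v w
  assoc_assocInv u v w := by
    refine heq_of_eq (ProfCell.ext fun {c d} t => ?_)
    induction t using Tensor.ind with
    | h d t z =>
      induction t using Tensor.ind with
      | h d x y => rfl
  assocInv_assoc u v w := by
    refine heq_of_eq (ProfCell.ext fun {c d} t => ?_)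
    induction t using Tensor.ind with
    | h d x t =>
      induction t using Tensor.ind with
      | h d y z => rfl
  assoc_naturality α β γ := by
    refine heq_of_eq (ProfCell.ext fun {c d} t => ?_)
    induction t using Tensor.ind with
    | h d t z =>
      induction t using Tensor.ind with
      | h d x y => rfl
  leftUnitor u := leftUnitorCell u
  leftUnitorInv u := leftUnitorInvCell u
  leftUnitor_inv {C D} u := by
    refine heq_of_eq (ProfCell.ext fun {c d} t => ?_)
    induction t using Tensor.ind with
    | h c' f x =>
      refine (tmul_act (u := homProf C) (v := u) f (𝟙 c) x).symm.trans ?_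
      refine congrArg (fun s => tmul (u := homProf C) (v := u) s x) ?_
      exact (Category.id_comp _).trans (Category.id_comp _)
  inv_leftUnitor {C D} u := by
    refine heq_of_eq (ProfCell.ext fun {c d} t => ?_)
    exact act_id u t
  leftUnitor_naturality {a b c d u v F G} α := by
    refine heq_of_eq (ProfCell.ext fun {c d} t => ?_)
    induction t using Tensor.ind with
    | h c' f x =>
      refine Eq.trans ?_ (ProfCell.naturality α f (𝟙 d) x).symm
      rw [G.toFunctor.map_id]
      rfl
  rightUnitor u := rightUnitorCell u
  rightUnitorInv u := rightUnitorInvCell u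
  rightUnitor_inv {C D} u := by
    refine heq_of_eq (ProfCell.ext fun {c d} t => ?_)
    induction t using Tensor.ind with
    | h d' x f =>
      refine (tmul_act (u := u) (v := homProf D) f x (𝟙 d)).trans ?_
      refine congrArg (tmul (u := u) (v := homProf D) x) ?_
      exact (congrArg (f ≫ ·) (Category.comp_id (𝟙 d))).trans (Category.comp_id f)
  inv_rightUnitor {C D} u := by
    refine heq_of_eq (ProfCell.ext fun {c d} t => ?_)
    exact act_id u t
  rightUnitor_naturality {a b c d u v F G} α := by
    refine heq_of_eq (ProfCell.ext fun {c d} t => ?_)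
    induction t using Tensor.ind with
    | h d' x f =>
      refine Eq.trans ?_ (ProfCell.naturality α (𝟙 c) f x).symm
      rw [F.toFunctor.map_id]
      rfl
  pentagon u v w x := by
    refine heq_of_eq (ProfCell.ext fun {c d} t => ?_)
    induction t using Tensor.ind with
    | h d t z =>
      induction t using Tensor.ind with
      | h d t y =>
        induction t using Tensor.ind with
        | h d r s => rfl
  triangle u v := by
    refine heq_of_eq (ProfCell.ext fun {c d} t => ?_)
    induction t using Tensor.ind with
    | h d t z =>
      induction t using Tensor.ind with
      | h d x f =>
        exact (tmul_act (u := u) (v := v) f x z).symm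

end Instance

section Index

variable {A : Type u} [SmallCategory A]

/-- The canonical cocone with vertex `A` under a lax `A`-indexed diagram of profunctors: it is
constant at `a` on the category over `a`, and sends all elements of the profunctor over `f`
to `f`. -/
def indexCocone (X : LaxDiagram A Cat.{u, u}) : Cocone X where
  pt := Cat.of A
  app a := ((Functor.const (X.obj a)).obj a).toCatHom
  cell {a b} f := ProfCell.mk (u := X.hor f) (F := (Functor.const (X.obj a)).obj a)
    (G := (Functor.const (X.obj b)).obj b) (v := homProf A) (fun _ => f)
    (fun _ _ _ => ((Category.id_comp _).trans (Category.comp_id f)).symm)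
  unit _ := heq_of_eq (ProfCell.ext fun _ => rfl)
  mul f g := by
    refine heq_of_eq (ProfCell.ext fun {c d} t => ?_)
    induction t using Tensor.ind with
    | h e x y => exact (congrArg (f ≫ ·) (Category.comp_id g)).symm

theorem desc_indexCocone (K : DoubleColimits A Cat.{u, u}) {X Y : LaxDiagram A Cat.{u, u}}
    (s : X ⟶ Y) : K.dcolim.map s ≫ K.desc (indexCocone Y) = K.desc (indexCocone X) := by
  refine (K.desc_comp_desc s (indexCocone Y)).trans ?_
  refine K.desc_eq _ _ (fun i => ?_) (fun f => ?_)
  · exact K.app_desc (indexCocone X) i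
  · exact K.cell_desc (indexCocone X) f

/-- Taking double colimits, as a functor from lax `A`-indexed horizontal diagrams in `Prof` to
the slice category `Cat / A`.  The structure functor of the double colimit is induced by the
canonical cocone with vertex `A`. -/
def dcolimOver (K : DoubleColimits A Cat.{u, u}) :
    LaxDiagram A Cat.{u, u} ⥤ Over (Cat.of A) where
  obj X := Over.mk (Y := K.dcolim.obj X) (K.desc (indexCocone X))
  map s := Over.homMk (K.dcolim.map s) (desc_indexCocone K s)
  map_id X := Over.OverMorphism.ext (K.dcolim.map_id X)
  map_comp s t := Over.OverMorphism.ext (K.dcolim.map_comp s t)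

end Index

section Fibre

variable {A X : Type u} [SmallCategory A] [SmallCategory X] (p : X ⥤ A)

/-- The fibre of a functor `p` over a morphism `f : a ⟶ b`: the profunctor between the fibres
over `a` and `b` whose elements are the morphisms lying over `f`. -/
def fibreProf {a b : A} (f : a ⟶ b) : Profunc (p.Fiber a) (p.Fiber b) :=
  ofAct (fun x y => { φ : x.1 ⟶ y.1 // p.IsHomLift f φ })
    (fun g h φ => ⟨g.1 ≫ φ.1 ≫ h.1, by
      have := g.2
      have := h.2
      have := φ.2
      infer_instance⟩)
    (fun φ => Subtype.ext ((Category.id_comp _).trans (Category.comp_id _)))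
    (fun f g f' g' φ => Subtype.ext (by
      change f'.1 ≫ (f.1 ≫ φ.1 ≫ g.1) ≫ g'.1 = (f'.1 ≫ f.1) ≫ φ.1 ≫ g.1 ≫ g'.1
      simp only [Category.assoc]))

theorem fibre_heq {C D : Cat.{u, u}} {a b : A} {F : C ⟶ Cat.of (p.Fiber a)}
    {G : D ⟶ Cat.of (p.Fiber b)} {u : Profunc C D} {f f' : a ⟶ b} (hf : f = f')
    {α : ProfCell u F.toFunctor G.toFunctor (fibreProf p f)}
    {α' : ProfCell u F.toFunctor G.toFunctor (fibreProf p f')}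
    (h : ∀ {c : C} {d : D} (x : El u c d), Subtype.val (α.app x) = Subtype.val (α'.app x)) :
    HEq α α' := by
  subst hf
  exact heq_of_eq (ProfCell.ext fun x => Subtype.ext (h x))

/-- The composition comparison `X_f ⊗ X_g ⟶ X_{f ≫ g}` of the fibres. -/
def fibreMul {a b c : A} (f : a ⟶ b) (g : b ⟶ c) :
    ProfCell (tensor (fibreProf p f) (fibreProf p g)) (𝟭 (p.Fiber a)) (𝟭 (p.Fiber c))
      (fibreProf p (f ≫ g)) where
  app {x z} := Tensor.lift (fun y (φ : { φ : x.1 ⟶ y.1 // p.IsHomLift f φ })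
      (ψ : { ψ : y.1 ⟶ z.1 // p.IsHomLift g ψ }) =>
      (⟨φ.1 ≫ ψ.1, by
        have := φ.2
        have := ψ.2
        infer_instance⟩ : { φ : x.1 ⟶ z.1 // p.IsHomLift (f ≫ g) φ }))
    (fun {y y'} k φ ψ => Subtype.ext (by
      change (𝟙 x.1 ≫ Subtype.val φ ≫ k.1) ≫ Subtype.val ψ =
        Subtype.val φ ≫ k.1 ≫ Subtype.val ψ ≫ 𝟙 z.1
      simp))
  naturality {x x' z z'} h k t := by
    induction t using Tensor.ind with
    | h y φ ψ =>
      refine Subtype.ext ?_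
      change (h.1 ≫ Subtype.val φ ≫ 𝟙 y.1) ≫ 𝟙 y.1 ≫ Subtype.val ψ ≫ k.1 =
        h.1 ≫ (Subtype.val φ ≫ Subtype.val ψ) ≫ k.1
      simp

/-- The lax diagram of fibres of a functor `p : X ⥤ A`. -/
def fibreDiagram : LaxDiagram A Cat.{u, u} where
  obj a := Cat.of (p.Fiber a)
  hor f := fibreProf p f
  unit a := ProfCell.mk (u := homProf (p.Fiber a)) (F := 𝟭 (p.Fiber a)) (G := 𝟭 (p.Fiber a))
    (v := fibreProf p (𝟙 a)) (fun φ => φ) (fun _ _ _ => rfl)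
  mul f g := fibreMul p f g
  mul_assoc f g h := by
    refine fibre_heq p (Category.assoc f g h) fun {c d} t => ?_
    induction t using Tensor.ind with
    | h y t ψ =>
      induction t using Tensor.ind with
      | h y φ χ => exact Category.assoc (Subtype.val φ) (Subtype.val χ) (Subtype.val ψ)
  unit_mul f := by
    refine fibre_heq p (Category.id_comp f) fun {c d} t => ?_
    induction t using Tensor.ind with
    | h y φ ψ => exact (congrArg (φ.1 ≫ ·) (Category.comp_id (Subtype.val ψ))).symm
  mul_unit f := by
    refine fibre_heq p (Category.comp_id f) fun {c d} t => ?_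
    induction t using Tensor.ind with
    | h y φ ψ => exact (Category.id_comp (Subtype.val φ ≫ ψ.1)).symm

/-- The cocone under the diagram of fibres of `p : X ⥤ A` with vertex `X`, given by the
inclusions of the fibres. -/
def fibreCocone : Cocone (fibreDiagram p) where
  pt := Cat.of X
  app _ := (Functor.Fiber.fiberInclusion (p := p)).toCatHom
  cell {a b} f := ProfCell.mk (u := fibreProf p f)
    (F := Functor.Fiber.fiberInclusion (p := p) (S := a))
    (G := Functor.Fiber.fiberInclusion (p := p) (S := b))
    (v := homProf X) (fun φ => Subtype.val φ) (fun _ _ _ => rfl)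
  unit _ := heq_of_eq (ProfCell.ext fun _ => rfl)
  mul f g := by
    refine heq_of_eq (ProfCell.ext fun {c d} t => ?_)
    induction t using Tensor.ind with
    | h y φ ψ => exact (congrArg (Subtype.val φ ≫ ·) (Category.comp_id (Subtype.val ψ))).symm

end Fibre

end Prof

open DoubleCategory Prof

/-!
The double colimit of a lax diagram `X` of profunctors indexed by `A` is its total category
`Total X`: the objects are pairs of `a : A` and an object of `X_a`, the morphisms over `f` are the
elements of the profunctor `X_f`, and identities and composition are given by the comparison cells
of `X`, the category axioms being the coherence laws of `X`. A cocone under `X` with vertex `V` is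
then the same as a functor `Total X ⥤ V` (`totalCoconeIsDoubleColimit`); normality plays no role.

For a functor `p : 𝒳 ⥤ A`, every object of `𝒳` lies in exactly one fibre, and every morphism is
an element of exactly one of the profunctors over the morphisms of `A`. Hence `𝒳` is the double
colimit of the fibres of `p` (`fibreCoconeIsDoubleColimit`), and the double colimit functor is
essentially surjective already on the diagrams of fibres, which are normal.

Normality of `Y` says exactly that the category `Y_a` is the fibre of `Total Y ⥤ A` over `a`:
morphisms over `𝟙 a` are elements of `Y_{𝟙 a}`, that is, morphisms of `Y_a`. Therefore a cocone
under `X` with vertex `Total Y`, compatible with the functors to `A`, factors uniquely through the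
canonical cocone of `Y` by a vertical transformation `X ⟶ Y` (`exists_precomp_of_over` and
`verticalTrans_ext_of_precomp`). This gives fullness and faithfulness. As any two double colimits
of a diagram are canonically isomorphic over `A`, all this holds for an arbitrary choice of double
colimits. The quasi-inverse is then forced to send `p` to a diagram isomorphic to that of its
fibres, since both have double colimit `p`.

Many equations involve objects which agree only propositionally; these are stated with `HEq`.
-/

namespace Prof

/-! ### Cells evaluated at elements -/

section Elements

variable {C D C' D' : Type u} [SmallCategory C] [SmallCategory D] [SmallCategory C']
  [SmallCategory D']

theorem ProfCell.app_congr {u : Profunc C D} {F : C ⥤ C'} {G : D ⥤ D'} {v : Profunc C' D'}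
    {α β : ProfCell u F G v} (h : α = β) {c : C} {d : D} (x : El u c d) : α.app x = β.app x := by
  rw [h]

theorem ProfCell.app_heq {u : Profunc C D} {F F' : C ⥤ C'} {G G' : D ⥤ D'} {v : Profunc C' D'}
    (hF : F = F') (hG : G = G') {α : ProfCell u F G v} {β : ProfCell u F' G' v} (h : HEq α β)
    {c : C} {d : D} (x : El u c d) : HEq (α.app x) (β.app x) := by
  subst hF hG
  cases h
  rfl

theorem ProfCell.heq_ext {u : Profunc C D} {F F' : C ⥤ C'} {G G' : D ⥤ D'} {v : Profunc C' D'}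
    (hF : F = F') (hG : G = G') {α : ProfCell u F G v} {β : ProfCell u F' G' v}
    (h : ∀ {c : C} {d : D} (x : El u c d), HEq (α.app x) (β.app x)) : HEq α β := by
  subst hF hG
  exact heq_of_eq (ProfCell.ext fun x => eq_of_heq (h x))

end Elements

/-! ### The total category of a lax diagram -/

section Total

variable {A : Type u} [SmallCategory A] (X : LaxDiagram A Cat.{u, u})

/-- Objects of the total category of a lax diagram of profunctors: pairs of an object `a` of `A`
and an object of the category over `a`. -/
structure Total : Type u where
  /-- the object of the index category -/
  base : A
  /-- the object of the category over it -/
  fib : X.obj base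

variable {X}

/-- Morphisms of the total category: a morphism `f` of `A` together with an element of the
profunctor over `f`. -/
structure Total.Hom (z w : Total X) : Type u where
  /-- the morphism of the index category -/
  base : z.base ⟶ w.base
  /-- the element of the profunctor over it -/
  el : El (C := X.obj z.base) (D := X.obj w.base) (X.hor base) z.fib w.fib

/-- The element of `X_{𝟙 a}` given by a morphism of `X_a`. -/
def unitEl (X : LaxDiagram A Cat.{u, u}) {a : A} {x y : X.obj a} (φ : x ⟶ y) :
    El (C := X.obj a) (D := X.obj a) (X.hor (𝟙 a)) x y :=
  ProfCell.app (u := homProf (X.obj a)) (F := 𝟭 (X.obj a)) (G := 𝟭 (X.obj a)) (X.unit a) φ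

/-- The composite in `X_{f ≫ g}` of elements of `X_f` and `X_g`. -/
def mulEl (X : LaxDiagram A Cat.{u, u}) {a b c : A} {f : a ⟶ b} {g : b ⟶ c}
    {x : X.obj a} {y : X.obj b} {z : X.obj c}
    (m : El (C := X.obj a) (D := X.obj b) (X.hor f) x y)
    (n : El (C := X.obj b) (D := X.obj c) (X.hor g) y z) :
    El (C := X.obj a) (D := X.obj c) (X.hor (f ≫ g)) x z :=
  ProfCell.app (u := tensor (X.hor f) (X.hor g)) (F := 𝟭 (X.obj a)) (G := 𝟭 (X.obj c))
    (X.mul f g) (tmul m n)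

/-- Equations between cells with bottoms `X_f` and `X_{f'}`, where `f = f'`, become honest equations
of morphisms of the total category. The coherence laws of a lax diagram are of this form. -/
theorem Total.Hom.mk_congr {a b : A} {C D : Type u} [SmallCategory C] [SmallCategory D]
    {u : Profunc C D} {F : C ⥤ X.obj a} {G : D ⥤ X.obj b} {f f' : a ⟶ b} (hf : f = f')
    {α : ProfCell u F G (X.hor f)} {β : ProfCell u F G (X.hor f')} (h : HEq α β)
    {c : C} {d : D} (x : El u c d) :
    (⟨f, α.app x⟩ : Total.Hom (X := X) ⟨a, F.obj c⟩ ⟨b, G.obj d⟩) = ⟨f', β.app x⟩ := by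
  subst hf
  cases h
  rfl

theorem mk_mulEl_assoc {a b c d : A} {f : a ⟶ b} {g : b ⟶ c} {h : c ⟶ d}
    {x : X.obj a} {y : X.obj b} {z : X.obj c} {w : X.obj d}
    (m : El (C := X.obj a) (D := X.obj b) (X.hor f) x y)
    (n : El (C := X.obj b) (D := X.obj c) (X.hor g) y z)
    (k : El (C := X.obj c) (D := X.obj d) (X.hor h) z w) :
    (⟨(f ≫ g) ≫ h, mulEl X (mulEl X m n) k⟩ : Total.Hom (X := X) ⟨a, x⟩ ⟨d, w⟩) =
      ⟨f ≫ g ≫ h, mulEl X m (mulEl X n k)⟩ :=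
  Total.Hom.mk_congr (u := tensor (tensor (X.hor f) (X.hor g)) (X.hor h)) (F := 𝟭 (X.obj a))
    (G := 𝟭 (X.obj d)) (Category.assoc f g h) (X.mul_assoc f g h)
    (tmul (u := tensor (X.hor f) (X.hor g)) (v := X.hor h) (tmul m n) k)

theorem mk_unitEl_mulEl {a b : A} {f : a ⟶ b} {x x' : X.obj a} {y : X.obj b} (φ : x' ⟶ x)
    (m : El (C := X.obj a) (D := X.obj b) (X.hor f) x y) :
    (⟨𝟙 a ≫ f, mulEl X (unitEl X φ) m⟩ : Total.Hom (X := X) ⟨a, x'⟩ ⟨b, y⟩) =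
      ⟨f, act (X.hor f) φ (𝟙 y) m⟩ :=
  Total.Hom.mk_congr (u := tensor (homProf (X.obj a)) (X.hor f)) (F := 𝟭 (X.obj a))
    (G := 𝟭 (X.obj b)) (Category.id_comp f) (X.unit_mul f)
    (tmul (u := homProf (X.obj a)) (v := X.hor f) φ m)

theorem mk_mulEl_unitEl {a b : A} {f : a ⟶ b} {x : X.obj a} {y y' : X.obj b}
    (m : El (C := X.obj a) (D := X.obj b) (X.hor f) x y) (ψ : y ⟶ y') :
    (⟨f ≫ 𝟙 b, mulEl X m (unitEl X ψ)⟩ : Total.Hom (X := X) ⟨a, x⟩ ⟨b, y'⟩) =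
      ⟨f, act (X.hor f) (𝟙 x) ψ m⟩ :=
  Total.Hom.mk_congr (u := tensor (X.hor f) (homProf (X.obj b))) (F := 𝟭 (X.obj a))
    (G := 𝟭 (X.obj b)) (Category.comp_id f) (X.mul_unit f)
    (tmul (u := X.hor f) (v := homProf (X.obj b)) m ψ)

theorem unitEl_comp {a : A} {x y z : X.obj a} (φ : x ⟶ y) (ψ : y ⟶ z) :
    unitEl X (φ ≫ ψ) = act (X.hor (𝟙 a)) φ (𝟙 z) (unitEl X ψ) := by
  have := ProfCell.naturality (u := homProf (X.obj a)) (F := 𝟭 (X.obj a)) (G := 𝟭 (X.obj a))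
    (X.unit a) φ (𝟙 z) ψ
  refine Eq.trans ?_ this
  refine congrArg (unitEl X) ?_
  exact congrArg (φ ≫ ·) (Category.comp_id ψ).symm

/-- The total category: identities and composition come from the comparison cells of the
diagram, and the laws from their coherence. -/
instance : SmallCategory (Total X) where
  Hom := Total.Hom
  id z := ⟨𝟙 z.base, unitEl X (𝟙 z.fib)⟩
  comp k l := ⟨k.base ≫ l.base, mulEl X k.el l.el⟩
  id_comp k := (mk_unitEl_mulEl (𝟙 _) k.el).trans (congrArg (Total.Hom.mk k.base) (act_id _ _))
  comp_id k := (mk_mulEl_unitEl k.el (𝟙 _)).trans (congrArg (Total.Hom.mk k.base) (act_id _ _))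
  assoc k l j := mk_mulEl_assoc k.el l.el j.el

/-- The morphism of the total category given by an element of the profunctor over `f`. -/
abbrev Total.homMk {a b : A} (f : a ⟶ b) {x : X.obj a} {y : X.obj b}
    (m : El (C := X.obj a) (D := X.obj b) (X.hor f) x y) :
    (⟨a, x⟩ : Total X) ⟶ ⟨b, y⟩ :=
  Total.Hom.mk f m

theorem Total.homMk_unitEl_comp {a b : A} {f : a ⟶ b} {x x' : X.obj a} {y : X.obj b}
    (φ : x' ⟶ x) (m : El (C := X.obj a) (D := X.obj b) (X.hor f) x y) :
    homMk (𝟙 a) (unitEl X φ) ≫ homMk f m = homMk f (act (X.hor f) φ (𝟙 y) m) :=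
  mk_unitEl_mulEl φ m

theorem Total.homMk_comp_unitEl {a b : A} {f : a ⟶ b} {x : X.obj a} {y y' : X.obj b}
    (m : El (C := X.obj a) (D := X.obj b) (X.hor f) x y) (ψ : y ⟶ y') :
    homMk f m ≫ homMk (𝟙 b) (unitEl X ψ) = homMk f (act (X.hor f) (𝟙 x) ψ m) :=
  mk_mulEl_unitEl m ψ

variable (X)

/-- The projection of the total category to the index category. -/
def Total.proj : Total X ⥤ A where
  obj := Total.base
  map := Total.Hom.base
  map_id _ := rfl
  map_comp _ _ := rfl

/-- The inclusion of the category over `a` in the total category. -/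
def Total.incl (a : A) : X.obj a ⥤ Total X where
  obj x := ⟨a, x⟩
  map φ := homMk (𝟙 a) (unitEl X φ)
  map_id _ := rfl
  map_comp φ ψ := by rw [homMk_unitEl_comp, unitEl_comp]

/-- The canonical cocone with vertex the total category. -/
def totalCocone : Cocone X where
  pt := Cat.of (Total X)
  app a := (Total.incl X a).toCatHom
  cell {a b} f := ProfCell.mk (u := X.hor f) (F := Total.incl X a) (G := Total.incl X b)
    (v := homProf (Total X)) (fun m => Total.homMk f m) (fun {x x' y y'} φ ψ m => by
      change Total.homMk f (act (X.hor f) φ ψ m) = Total.homMk (𝟙 a) (unitEl X φ) ≫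
        Total.homMk f m ≫ Total.homMk (𝟙 b) (unitEl X ψ)
      rw [Total.homMk_comp_unitEl, Total.homMk_unitEl_comp, act_act, Category.comp_id,
        Category.comp_id])
  unit _ := heq_of_eq (ProfCell.ext fun _ => rfl)
  mul {a b c} f g := by
    refine heq_of_eq (ProfCell.ext fun {x z} t => ?_)
    induction t using Tensor.ind with
    | h y m n => exact (congrArg (Total.homMk f m ≫ ·) (Category.comp_id (Total.homMk g n))).symm

variable {X}

/-! ### Cocones in terms of elements -/

section Cocone

variable (d : Cocone X)

/-- The morphism of the vertex of a cocone given by an element of a profunctor. -/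
def cellEl {a b : A} (f : a ⟶ b) {x : X.obj a} {y : X.obj b}
    (m : El (C := X.obj a) (D := X.obj b) (X.hor f) x y) :
    (d.app a).toFunctor.obj x ⟶ (d.app b).toFunctor.obj y :=
  ProfCell.app (u := X.hor f) (F := (d.app a).toFunctor) (G := (d.app b).toFunctor)
    (v := homProf d.pt) (d.cell f) m

theorem cellEl_unitEl {a : A} {x y : X.obj a} (φ : x ⟶ y) :
    cellEl d (𝟙 a) (unitEl X φ) = (d.app a).toFunctor.map φ :=
  ProfCell.app_congr (u := homProf (X.obj a)) (F := (d.app a).toFunctor)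
    (G := (d.app a).toFunctor) (v := homProf d.pt) (eq_of_heq (d.unit a)) φ

theorem cellEl_mulEl {a b c : A} {f : a ⟶ b} {g : b ⟶ c}
    {x : X.obj a} {y : X.obj b} {z : X.obj c}
    (m : El (C := X.obj a) (D := X.obj b) (X.hor f) x y)
    (n : El (C := X.obj b) (D := X.obj c) (X.hor g) y z) :
    cellEl d (f ≫ g) (mulEl X m n) = cellEl d f m ≫ cellEl d g n :=
  (ProfCell.app_congr (u := tensor (X.hor f) (X.hor g)) (F := (d.app a).toFunctor)
    (G := (d.app c).toFunctor) (v := homProf d.pt) (eq_of_heq (d.mul f g)) (tmul m n)).trans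
    (congrArg (cellEl d f m ≫ ·) (Category.comp_id (cellEl d g n)))

theorem cellEl_act {a b : A} (f : a ⟶ b) {x x' : X.obj a} {y y' : X.obj b} (φ : x' ⟶ x)
    (ψ : y ⟶ y') (m : El (C := X.obj a) (D := X.obj b) (X.hor f) x y) :
    cellEl d f (act (X.hor f) φ ψ m) =
      (d.app a).toFunctor.map φ ≫ cellEl d f m ≫ (d.app b).toFunctor.map ψ :=
  ProfCell.naturality (u := X.hor f) (F := (d.app a).toFunctor) (G := (d.app b).toFunctor)
    (v := homProf d.pt) (d.cell f) φ ψ m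

theorem coconeHom_obj {c d : Cocone X} (h : c ⟶ d) {a : A} (x : X.obj a) :
    (Cocone.Hom.hom h).toFunctor.obj ((c.app a).toFunctor.obj x) = (d.app a).toFunctor.obj x :=
  congrArg (fun F => F.toFunctor.obj x) (Cocone.Hom.app h a)

theorem coconeHom_map_heq {c d : Cocone X} (h : c ⟶ d) {a b : A} (f : a ⟶ b) {x : X.obj a}
    {y : X.obj b} (m : El (C := X.obj a) (D := X.obj b) (X.hor f) x y) :
    HEq ((Cocone.Hom.hom h).toFunctor.map (cellEl c f m)) (cellEl d f m) :=
  ProfCell.app_heq (u := X.hor f) (v := homProf d.pt)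
    (congrArg Cat.Hom.toFunctor (Cocone.Hom.app h a))
    (congrArg Cat.Hom.toFunctor (Cocone.Hom.app h b)) (Cocone.Hom.cell h f) m

/-- A functor between the vertices of two cocones is a morphism of cocones as soon as it respects
the components elementwise. -/
def coconeHomMk {c d : Cocone X} (F : c.pt ⥤ d.pt)
    (hobj : ∀ {a : A} (x : X.obj a),
      F.obj ((c.app a).toFunctor.obj x) = (d.app a).toFunctor.obj x)
    (hmap : ∀ {a b : A} (f : a ⟶ b) {x : X.obj a} {y : X.obj b}
      (m : El (C := X.obj a) (D := X.obj b) (X.hor f) x y),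
      HEq (F.map (cellEl c f m)) (cellEl d f m)) : c ⟶ d :=
  -- compatibility with the functors on the fibres is the case of elements coming from the units
  have happ (a : A) : (c.app a).toFunctor ⋙ F = (d.app a).toFunctor :=
    Functor.hext hobj fun _ _ φ => by
      have h := hmap (𝟙 a) (unitEl X φ)
      rw [cellEl_unitEl, cellEl_unitEl] at h
      exact h
  { hom := Cat.Hom.ofFunctor F
    app := fun a => Cat.ext (happ a)
    cell := fun {a b} f => ProfCell.heq_ext (u := X.hor f) (v := homProf d.pt)
      (F := (c.app a).toFunctor ⋙ F) (G := (c.app b).toFunctor ⋙ F)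
      (α := ProfCell.vcomp (v := homProf c.pt) (w := homProf d.pt)
        (F := (c.app a).toFunctor) (G := (c.app b).toFunctor) (c.cell f) (ProfCell.hid F))
      (happ a) (happ b) (fun m => hmap f m) }

/-- The functor from the total category to the vertex of a cocone. -/
def Total.desc : Total X ⥤ d.pt where
  obj z := (d.app z.base).toFunctor.obj z.fib
  map k := cellEl d k.base k.el
  map_id z := (cellEl_unitEl d (𝟙 z.fib)).trans ((d.app z.base).toFunctor.map_id z.fib)
  map_comp k l := cellEl_mulEl d k.el l.el

end Cocone

variable (X)

/-- The total category is a double colimit, whether or not the diagram is normal. -/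
def totalCoconeIsDoubleColimit : (totalCocone X).IsDoubleColimit :=
  Limits.IsInitial.ofUniqueHom
    (fun d => coconeHomMk (c := totalCocone X) (Total.desc d) (fun _ => rfl)
      (fun _ _ _ _ => HEq.rfl))
    (fun _ h => Cocone.Hom.ext <| Cat.ext <| Functor.hext
      (fun (z : Total X) => coconeHom_obj h z.fib)
      (fun (z w : Total X) (k : Total.Hom z w) => coconeHom_map_heq h k.base k.el))

end Total

/-! ### The double colimit of the diagram of fibres -/

section FibreColimit

variable {A X : Type u} [SmallCategory A] [SmallCategory X] (p : X ⥤ A)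

/-- The fibres form a normal diagram: both `hom` of the fibre over `a` and the profunctor over `𝟙 a`
consist of the morphisms over `𝟙 a`. -/
theorem isNormal_fibreDiagram : (fibreDiagram p).IsNormal := fun a =>
  ⟨ProfCell.mk (u := fibreProf p (𝟙 a)) (F := 𝟭 (p.Fiber a)) (G := 𝟭 (p.Fiber a))
    (v := homProf (p.Fiber a)) (fun φ => φ) (fun _ _ _ => rfl), HEq.rfl, HEq.rfl⟩

/-- The morphism of cocones from the cocone of fibres to the canonical cocone over the index
category, with underlying functor `p`. -/
def fibreCoconeToIndexCocone : fibreCocone p ⟶ indexCocone (fibreDiagram p) :=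
  coconeHomMk (c := fibreCocone p) (d := indexCocone (fibreDiagram p)) p (fun x => x.2)
    (fun {a b} f x y φ => by
      obtain ⟨x, rfl⟩ := x
      obtain ⟨y, rfl⟩ := y
      obtain ⟨φ, hφ⟩ := φ
      exact heq_of_eq (IsHomLift.eq_of_isHomLift p f φ).symm)

/-- An object of `X` as an object of the fibre containing it. -/
abbrev fibreObj (x : X) : p.Fiber (p.obj x) := ⟨x, rfl⟩

/-- A morphism `φ` of `X` as an element of the profunctor over `p.map φ`. -/
abbrev fibreEl {x y : X} (φ : x ⟶ y) :
    El (fibreProf p (p.map φ)) (fibreObj p x) (fibreObj p y) :=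
  (⟨φ, .map φ⟩ : { ψ : x ⟶ y // p.IsHomLift (p.map φ) ψ })

section Desc

variable {p} (d : Cocone (fibreDiagram p))

theorem cellEl_fibre_congr {a b : A} {f f' : a ⟶ b} (hf : f = f') {x : p.Fiber a}
    {y : p.Fiber b} {φ : El (fibreProf p f) x y} {φ' : El (fibreProf p f') x y}
    (h : Subtype.val φ = Subtype.val φ') :
    cellEl d f (x := x) (y := y) φ = cellEl d f' (x := x) (y := y) φ' := by
  subst hf
  exact congrArg (cellEl d f (x := x) (y := y)) (Subtype.ext h)

/-- The functor from `X` to the vertex of a cocone under the diagram of fibres of `p : X ⥤ A`. -/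
def fibreDesc : X ⥤ d.pt where
  obj x := (d.app (p.obj x)).toFunctor.obj (fibreObj p x)
  map {x y} φ := cellEl d (p.map φ) (x := fibreObj p x) (y := fibreObj p y) (fibreEl p φ)
  map_id x := by
    refine (cellEl_fibre_congr d (p.map_id x) (x := fibreObj p x) (y := fibreObj p x)
      (φ' := 𝟙 (fibreObj p x)) rfl).trans ?_
    exact (cellEl_unitEl d (x := fibreObj p x) (y := fibreObj p x) (𝟙 (fibreObj p x))).trans
      ((d.app (p.obj x)).toFunctor.map_id (fibreObj p x))
  map_comp {x y z} φ ψ := by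
    refine (cellEl_fibre_congr d (p.map_comp φ ψ) (x := fibreObj p x) (y := fibreObj p z)
      (φ' := mulEl (fibreDiagram p) (x := fibreObj p x) (y := fibreObj p y) (z := fibreObj p z)
        (fibreEl p φ) (fibreEl p ψ)) rfl).trans ?_
    exact cellEl_mulEl d (x := fibreObj p x) (y := fibreObj p y) (z := fibreObj p z)
      (fibreEl p φ) (fibreEl p ψ)

theorem fibreDesc_obj {a : A} (x : p.Fiber a) :
    (fibreDesc d).obj x.1 = (d.app a).toFunctor.obj x := by
  obtain ⟨x, rfl⟩ := x
  rfl

theorem fibreDesc_map_heq {a b : A} (f : a ⟶ b) (x : p.Fiber a) (y : p.Fiber b)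
    (φ : { φ : x.1 ⟶ y.1 // p.IsHomLift f φ }) :
    HEq ((fibreDesc d).map φ.1) (cellEl d f (x := x) (y := y) φ) := by
  obtain ⟨x, rfl⟩ := x
  obtain ⟨y, rfl⟩ := y
  obtain ⟨φ, hφ⟩ := φ
  obtain rfl := IsHomLift.eq_of_isHomLift p f φ
  rfl

end Desc

/-- The category `X` is the double colimit of the fibres of `p : X ⥤ A`: an object of `X` lies in
exactly one fibre and a morphism `φ` of `X` is exactly one element of the profunctor over
`p.map φ`. -/
def fibreCoconeIsDoubleColimit : (fibreCocone p).IsDoubleColimit :=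
  Limits.IsInitial.ofUniqueHom
    (fun d => coconeHomMk (c := fibreCocone p) (fibreDesc d) (fibreDesc_obj d)
      (fun f x y φ => fibreDesc_map_heq d f x y φ))
    (fun _ h => Cocone.Hom.ext <| Cat.ext <| Functor.hext
      (fun x => coconeHom_obj h (fibreObj p x))
      (fun x y φ => coconeHom_map_heq h (p.map φ) (x := fibreObj p x) (y := fibreObj p y)
        (fibreEl p φ)))

end FibreColimit

/-! ### Factorizations through a faithful functor -/

section Factor

variable {C D V : Type u} [SmallCategory C] [SmallCategory D] [SmallCategory V]

/-- A functor whose values lie in the image of a faithful functor `I` factors through `I`. -/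
theorem exists_comp_eq_of_faithful (I : D ⥤ V) [I.Faithful] (F : C ⥤ V)
    (hobj : ∀ x, ∃ y, I.obj y = F.obj x)
    (hmap : ∀ {x x' : C} (φ : x ⟶ x') {y y' : D}, I.obj y = F.obj x → I.obj y' = F.obj x' →
      ∃ ψ : y ⟶ y', HEq (I.map ψ) (F.map φ)) :
    ∃ G : C ⥤ D, G ⋙ I = F := by
  choose o ho using hobj
  choose m hm using fun {x x' : C} (φ : x ⟶ x') => hmap φ (ho x) (ho x')
  refine ⟨{ obj := o, map := m, map_id := fun x => ?_, map_comp := fun {x y z} φ ψ => ?_ },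
    Functor.hext ho fun _ _ φ => hm φ⟩
  · refine I.map_injective (eq_of_heq ((hm (𝟙 x)).trans ?_))
    rw [F.map_id, I.map_id, ho]
  · refine I.map_injective (eq_of_heq ((hm (φ ≫ ψ)).trans ?_))
    rw [F.map_comp, I.map_comp]
    exact (heq_comp (ho x) (ho y) (ho z) (hm φ) (hm ψ)).symm

/-- A functor which is faithful and injective on objects is a monomorphism. -/
theorem eq_of_comp_eq_of_faithful (I : D ⥤ V) [I.Faithful] (hI : Function.Injective I.obj)
    {F G : C ⥤ D} (h : F ⋙ I = G ⋙ I) : F = G := by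
  have hobj : ∀ x, F.obj x = G.obj x := fun x => hI (Functor.congr_obj h x)
  refine CategoryTheory.Functor.ext hobj fun x y φ => I.map_injective ?_
  refine (Functor.congr_hom h φ).trans ?_
  simp [eqToHom_map]

end Factor

/-! ### Normal diagrams and their total categories -/

section Normal

variable {A : Type u} [SmallCategory A] {X Y : LaxDiagram A Cat.{u, u}}

/-- The elementwise form of the invertibility of the unit comparisons. -/
theorem unitEl_bijective (hY : Y.IsNormal) {a : A} (x y : Y.obj a) :
    Function.Bijective (unitEl Y : (x ⟶ y) → _) := by
  obtain ⟨β, h₁, h₂⟩ := hY a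
  refine Function.bijective_iff_has_inverse.mpr
    ⟨ProfCell.app (u := Y.hor (𝟙 a)) (F := 𝟭 (Y.obj a)) (G := 𝟭 (Y.obj a))
      (v := homProf (Y.obj a)) β, fun φ => ?_, fun m => ?_⟩
  · exact ProfCell.app_congr (u := homProf (Y.obj a)) (F := 𝟭 (Y.obj a)) (G := 𝟭 (Y.obj a))
      (v := homProf (Y.obj a)) (eq_of_heq h₁) φ
  · exact ProfCell.app_congr (u := Y.hor (𝟙 a)) (F := 𝟭 (Y.obj a)) (G := 𝟭 (Y.obj a))
      (v := Y.hor (𝟙 a)) (eq_of_heq h₂) m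

theorem Total.homMk_injective {a b : A} (f : a ⟶ b) {x : Y.obj a} {y : Y.obj b} :
    Function.Injective (Total.homMk f : El (C := Y.obj a) (D := Y.obj b) (Y.hor f) x y → _) :=
  fun _ _ h => eq_of_heq (Total.Hom.mk.inj h).2

theorem Total.incl_faithful (hY : Y.IsNormal) (a : A) : (Total.incl Y a).Faithful :=
  ⟨fun {x y} _ _ h => (unitEl_bijective hY x y).1 (Total.homMk_injective (𝟙 a) h)⟩

theorem Total.incl_obj_injective (a : A) : Function.Injective (Total.incl Y a).obj :=
  fun _ _ h => eq_of_heq (Total.mk.inj h).2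

theorem Total.exists_mk_eq {a : A} {z : Total Y} (h : z.base = a) :
    ∃ x, (⟨a, x⟩ : Total Y) = z := by
  subst h
  exact ⟨z.fib, rfl⟩

/-- A morphism of the total category over `f` is given by an element of `Y_f`. -/
theorem Total.exists_homMk_heq {z w : Total Y} {a b : A} {x : Y.obj a} {y : Y.obj b}
    (hz : ⟨a, x⟩ = z) (hw : ⟨b, y⟩ = w) (k : z ⟶ w) (f : a ⟶ b)
    (hk : HEq ((Total.proj Y).map k) f) : ∃ n, HEq (Total.homMk f (x := x) (y := y) n) k := by
  subst hz hw
  cases hk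
  exact ⟨Total.Hom.el k, HEq.rfl⟩

/-- Vertical transformations into a normal diagram are determined by the induced cocones with vertex
the total category. -/
theorem verticalTrans_ext_of_precomp (hY : Y.IsNormal) {s t : X ⟶ Y}
    (happ : ∀ a, ((totalCocone Y).precomp s).app a = ((totalCocone Y).precomp t).app a)
    (hcell : ∀ {a b : A} (f : a ⟶ b), HEq (((totalCocone Y).precomp s).cell f)
      (((totalCocone Y).precomp t).cell f)) : s = t := by
  obtain ⟨S, cS, _, _⟩ := s
  obtain ⟨T, cT, _, _⟩ := t
  obtain rfl : S = T := by
    funext a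
    have := Total.incl_faithful hY a
    exact Cat.ext (eq_of_comp_eq_of_faithful (Total.incl Y a) (Total.incl_obj_injective a)
      (congrArg Cat.Hom.toFunctor (happ a)))
  refine VerticalTrans.ext' (fun _ => rfl) fun {a b} f => heq_of_eq (ProfCell.ext fun m => ?_)
  refine Total.homMk_injective f ?_
  exact ProfCell.app_congr (u := X.hor f) (v := homProf (Total Y))
    (F := (S a).toFunctor ⋙ Total.incl Y a) (G := (S b).toFunctor ⋙ Total.incl Y b)
    (eq_of_heq (hcell f)) m

variable (Y) in
/-- The morphism of cocones from the canonical cocone with vertex the total category to the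
canonical cocone with vertex the index category, given by the projection. -/
def totalCoconeToIndexCocone : totalCocone Y ⟶ indexCocone Y where
  hom := (Total.proj Y).toCatHom
  app _ := rfl
  cell _ := HEq.rfl

/-- If `Y` is normal, every functor over `A` from the vertex of a cocone under `X` to the total
category of `Y` is induced by a vertical transformation `X ⟶ Y`. -/
theorem exists_precomp_of_over (hY : Y.IsNormal) (c : Cocone X) (h : c.pt ⟶ Cat.of (Total Y))
    (l : c ⟶ indexCocone X) (hl : Cocone.Hom.hom l = h ≫ (Total.proj Y).toCatHom) :
    ∃ (s : X ⟶ Y) (k : c ⟶ (totalCocone Y).precomp s), Cocone.Hom.hom k = h := by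
  have hobj : ∀ {a : A} (x : X.obj a),
      (h.toFunctor.obj ((c.app a).toFunctor.obj x)).base = a := fun {a} x => by
    have := coconeHom_obj l x
    rw [hl] at this
    exact this
  have hmap : ∀ {a b : A} (f : a ⟶ b) {x : X.obj a} {y : X.obj b}
      (m : El (C := X.obj a) (D := X.obj b) (X.hor f) x y),
      HEq ((Total.proj Y).map (h.toFunctor.map (cellEl c f m))) f := fun {a b} f {x y} m => by
    have := coconeHom_map_heq l f m
    rw [hl] at this
    exact this
  -- The given functor sends the image of `X_a` into the subcategory `Y_a` of `Total Y`; on morphisms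
  -- this uses that all elements of `Y_{𝟙 a}` come from morphisms of `Y_a`.
  have key : ∀ a, ∃ G : X.obj a ⥤ Y.obj a,
      G ⋙ Total.incl Y a = (c.app a).toFunctor ⋙ h.toFunctor := fun a => by
    have := Total.incl_faithful hY a
    refine exists_comp_eq_of_faithful _ _ (fun x => Total.exists_mk_eq (hobj x)) ?_
    intro x x' φ y y' hy hy'
    obtain ⟨n, hn⟩ := Total.exists_homMk_heq hy hy' _ (𝟙 a) (hmap (𝟙 a) (unitEl X φ))
    obtain ⟨ψ, rfl⟩ := (unitEl_bijective hY y y').2 n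
    refine ⟨ψ, hn.trans (heq_of_eq ?_)⟩
    rw [cellEl_unitEl]
    rfl
  choose G hG using key
  have hGobj : ∀ {a : A} (x : X.obj a),
      (⟨a, (G a).obj x⟩ : Total Y) = h.toFunctor.obj ((c.app a).toFunctor.obj x) :=
    fun {a} x => Functor.congr_obj (hG a) x
  have hGmap : ∀ {a : A} {x y : X.obj a} (φ : x ⟶ y),
      HEq (Total.homMk (𝟙 a) (unitEl Y ((G a).map φ)))
        (h.toFunctor.map ((c.app a).toFunctor.map φ)) :=
    fun {a x y} φ => Functor.hcongr_hom (hG a) φ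
  choose n hn using fun {a b : A} (f : a ⟶ b) {x : X.obj a} {y : X.obj b}
      (m : El (C := X.obj a) (D := X.obj b) (X.hor f) x y) =>
    Total.exists_homMk_heq (hGobj x) (hGobj y) _ f (hmap f m)
  -- As an element of `Y_f` is determined by the morphism of `Total Y` which it defines, the axioms
  -- for a vertical transformation follow from the functoriality of `h` and the axioms for `c`.
  let s : VerticalTrans X Y :=
    { app := fun a => Cat.Hom.ofFunctor (G a)
      cell := fun {a b} f => ProfCell.mk (u := X.hor f) (F := G a) (G := G b) (v := Y.hor f)
        (n f) (fun {x x' y y'} φ ψ m => by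
          refine Total.homMk_injective f (eq_of_heq ((hn f _).trans ?_))
          rw [cellEl_act, Functor.map_comp, Functor.map_comp]
          refine HEq.trans ?_ (heq_of_eq
            (cellEl_act (totalCocone Y) f ((G a).map φ) ((G b).map ψ) (n f m)).symm)
          exact (heq_comp (hGobj x') (hGobj x) (hGobj y') (hGmap φ)
            (heq_comp (hGobj x) (hGobj y) (hGobj y') (hn f m) (hGmap ψ))).symm)
      unit := fun a => heq_of_eq (ProfCell.ext fun {x y} φ => by
        refine Total.homMk_injective (𝟙 a) (eq_of_heq ((hn (𝟙 a) (unitEl X φ)).trans ?_))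
        exact (heq_of_eq (congrArg h.toFunctor.map (cellEl_unitEl c (x := x) (y := y) φ))).trans
          (hGmap (x := x) (y := y) φ).symm)
      mul := fun {a b e} f g => heq_of_eq (ProfCell.ext fun {x z} t => by
        induction t using Tensor.ind with
        | h y m m' =>
          refine Total.homMk_injective (f ≫ g) (eq_of_heq ((hn (f ≫ g) (mulEl X m m')).trans ?_))
          rw [cellEl_mulEl, Functor.map_comp]
          exact (heq_comp (hGobj x) (hGobj y) (hGobj z) (hn f m) (hn g m')).symm) }
  exact ⟨s, coconeHomMk (d := (totalCocone Y).precomp s) h.toFunctor (fun x => (hGobj x).symm)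
    (fun f _ _ m => (hn f m).symm), rfl⟩

end Normal

/-! ### The equivalence of normal diagrams and categories over the index category -/

section Equivalence

variable {A : Type u} [SmallCategory A] (K : DoubleColimits A Cat.{u, u})

/-- Two double colimits of a diagram have isomorphic vertices. -/
def ptIso {X : LaxDiagram A Cat.{u, u}} {c c' : Cocone X} (hc : c.IsDoubleColimit)
    (hc' : c'.IsDoubleColimit) : c.pt ≅ c'.pt where
  hom := Cocone.Hom.hom (hc.to c')
  inv := Cocone.Hom.hom (hc'.to c)
  hom_inv_id := congrArg Cocone.Hom.hom (hc.hom_ext (hc.to c' ≫ hc'.to c) (𝟙 c))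
  inv_hom_id := congrArg Cocone.Hom.hom (hc'.hom_ext (hc'.to c ≫ hc.to c') (𝟙 c'))

theorem map_comp_desc_totalCocone {X Y : LaxDiagram A Cat.{u, u}} (s : X ⟶ Y) :
    K.dcolim.map s ≫ K.desc (totalCocone Y) = K.desc ((totalCocone Y).precomp s) :=
  K.desc_comp_desc s (totalCocone Y)

/-- The comparison of the chosen double colimit with the total category is a functor over `A`. -/
theorem desc_totalCocone_comp_proj (Y : LaxDiagram A Cat.{u, u}) :
    K.desc (totalCocone Y) ≫ (Total.proj Y).toCatHom = K.desc (indexCocone Y) :=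
  congrArg Cocone.Hom.hom ((K.isDoubleColimit Y).hom_ext
    ((K.isDoubleColimit Y).to (totalCocone Y) ≫ totalCoconeToIndexCocone Y)
    ((K.isDoubleColimit Y).to (indexCocone Y)))

instance mono_desc_totalCocone (Y : LaxDiagram A Cat.{u, u}) :
    Mono (K.desc (totalCocone Y)) :=
  inferInstanceAs (Mono (ptIso (K.isDoubleColimit Y) (totalCoconeIsDoubleColimit Y)).hom)

/-- The double colimit functor on the normal lax diagrams. -/
abbrev normalDcolimOver : (normalDiagrams A Cat.{u, u}).FullSubcategory ⥤ Over (Cat.of A) :=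
  (normalDiagrams A Cat.{u, u}).ι ⋙ dcolimOver K

instance faithful_normalDcolimOver : (normalDcolimOver K).Faithful where
  map_injective {X Y} s t hst := by
    refine ObjectProperty.hom_ext _ ?_
    have h : K.desc ((totalCocone Y.obj).precomp s.hom) =
        K.desc ((totalCocone Y.obj).precomp t.hom) := by
      rw [← map_comp_desc_totalCocone, ← map_comp_desc_totalCocone]
      exact congrArg (fun k => k.left ≫ K.desc (totalCocone Y.obj)) hst
    refine verticalTrans_ext_of_precomp Y.property (fun a => ?_) (fun f => ?_)
    · rw [← K.app_desc ((totalCocone Y.obj).precomp s.hom), h]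
      exact K.app_desc ((totalCocone Y.obj).precomp t.hom) a
    · refine (K.cell_desc ((totalCocone Y.obj).precomp s.hom) f).symm.trans ?_
      rw [h]
      exact K.cell_desc ((totalCocone Y.obj).precomp t.hom) f

instance full_normalDcolimOver : (normalDcolimOver K).Full where
  map_surjective {X Y} g := by
    obtain ⟨s, k, hk⟩ := exists_precomp_of_over Y.property (K.cocone X.obj)
      (g.left ≫ K.desc (totalCocone Y.obj)) ((K.isDoubleColimit X.obj).to (indexCocone X.obj))
      (((Category.assoc _ _ _).trans
        ((congrArg (g.left ≫ ·) (desc_totalCocone_comp_proj K Y.obj)).trans (Over.w g))).symm)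
    refine ⟨ObjectProperty.homMk s, Over.OverMorphism.ext ?_⟩
    refine (mono_desc_totalCocone K Y.obj).right_cancellation _ _ ?_
    refine (map_comp_desc_totalCocone K s).trans (Eq.trans ?_ hk)
    exact congrArg Cocone.Hom.hom ((K.isDoubleColimit X.obj).hom_ext
      ((K.isDoubleColimit X.obj).to ((totalCocone Y.obj).precomp s)) k)

/-- The double colimit of the diagram of fibres of a functor `p`, as a category over the index
category, is `p`. -/
def dcolimOverFibreIso {X : Type u} [SmallCategory X] (p : X ⥤ A) :
    (dcolimOver K).obj (fibreDiagram p) ≅ Over.mk p.toCatHom :=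
  Over.isoMk (ptIso (K.isDoubleColimit _) (fibreCoconeIsDoubleColimit p))
    (congrArg Cocone.Hom.hom ((K.isDoubleColimit (fibreDiagram p)).hom_ext
      ((K.isDoubleColimit (fibreDiagram p)).to (fibreCocone p) ≫ fibreCoconeToIndexCocone p)
      ((K.isDoubleColimit (fibreDiagram p)).to (indexCocone (fibreDiagram p)))))

instance essSurj_normalDcolimOver : (normalDcolimOver K).EssSurj where
  mem_essImage Z := ⟨⟨fibreDiagram Z.hom.toFunctor, isNormal_fibreDiagram _⟩,
    ⟨dcolimOverFibreIso K Z.hom.toFunctor⟩⟩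

instance isEquivalence_normalDcolimOver : (normalDcolimOver K).IsEquivalence where

end Equivalence

end Prof

theorem mainTheorem2 (A : Type u) [SmallCategory A] :
    (∀ X : LaxDiagram A Cat.{u, u}, ∃ c : Cocone X, Nonempty c.IsDoubleColimit) ∧
    (∀ K : DoubleColimits A Cat.{u, u},
      ∃ e : (normalDiagrams A Cat.{u, u}).FullSubcategory ≌ Over (Cat.of A),
        e.functor = (normalDiagrams A Cat.{u, u}).ι ⋙ dcolimOver K ∧
        ∀ (X : Type u) [SmallCategory X] (p : X ⥤ A),
          Nonempty ((e.inverse.obj (Over.mk p.toCatHom)).obj ≅ fibreDiagram p)) ∧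
    (∀ (X : Type u) [SmallCategory X] (p : X ⥤ A),
      (fibreDiagram p).IsNormal ∧
      Nonempty (fibreCocone p).IsDoubleColimit ∧
      ∃ h : fibreCocone p ⟶ indexCocone (fibreDiagram p), Cocone.Hom.hom h = p.toCatHom) := by
  refine ⟨fun X => ⟨totalCocone X, ⟨totalCoconeIsDoubleColimit X⟩⟩,
    fun K => ⟨(normalDcolimOver K).asEquivalence, rfl, fun X _ p => ?_⟩,
    fun X _ p => ⟨isNormal_fibreDiagram p, ⟨fibreCoconeIsDoubleColimit p⟩,
      fibreCoconeToIndexCocone p, rfl⟩⟩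
  -- The counit identifies the double colimit of the value of the quasi-inverse at `p` with `p`, which
  -- is also the double colimit of the fibres; full faithfulness lifts this to the diagrams.
  let F : (normalDiagrams A Cat.{u, u}).FullSubcategory :=
    ⟨fibreDiagram p, isNormal_fibreDiagram p⟩
  let e := (normalDcolimOver K).asEquivalence
  let i : (normalDcolimOver K).obj F ≅ Over.mk p.toCatHom := dcolimOverFibreIso K p
  let j : e.inverse.obj (Over.mk p.toCatHom) ≅ F :=
    (normalDcolimOver K).preimageIso (e.counitIso.app (Over.mk p.toCatHom) ≪≫ i.symm)
  exact ⟨(normalDiagrams A Cat.{u, u}).ι.mapIso j⟩
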